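/- **Setting.** Let $(\mathcal X,d)$ and $(\mathcal Y,\delta)$ be complete separable metric spaces, let $(\varepsilon_i)_{i\ge1}$ be i.i.d. copies of a $\mathcal Y$-valued random variable $\varepsilon$, and let $X_1$ be an $\mathcal X$-valued random variable independent of $(\varepsilon_i)_{i\ge2}$. Let $X_n=F_n(X_{n-1},\varepsilon_n)$ for $n\ge2$, where the measurable maps $F_n:\mathcal X\times\mathcal Y\to\mathcal X$ satisfy, for all $n\ge2$, $x,x'\in\mathcal X$, $y,y'\in\mathcal Y$, $$\mathbb E\,d(F_n(x,\varepsilon_1),F_n(x',\varepsilon_1))\le\rho_n\,d(x,x'),\qquad d(F_n(x,y),F_n(x,y'))\le\tau_n\,\delta(y,y')+\xi_n,$$ with $\rho_n\in[0,1)$ and $\tau_n,\xi_n\ge0$. Let $p\in[1,\infty]$, let $\mathbb R^d$ ($d\ge1$ an integer) carry the norm $\|\cdot\|_p$, and let $f=f_n:\mathcal X^n\to\mathbb R^d$ ($n\ge2$) be such that $\|f(x_1,\dots,x_n)-f(x_1',\dots,x_n')\|_p\le\sum_{i=1}^n d(x_i,x_i')$. Put $S_n=f(X_1,\dots,X_n)-\mathbb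 E f(X_1,\dots,X_n)$, $K_{k,n}=1+\rho_{k+1}+\rho_{k+1}\rho_{k+2}+\dots+\rho_{k+1}\cdots\rho_n$ for $k<n$, $K_{n,n}=1$, $G_{X_1}(x)=\int d(x,x')\,\mathbb P_{X_1}(dx')\in[0,\infty]$ and $$I_1(x)=d\;\mathbb P\Big(G_{X_1}(X_1)\ge\frac{x}{2K_{1,n}}\Big).$$ (If $f(X_1,\dots,X_n)$ is not integrable, then under the assumption on $\varepsilon$ below $G_{X_1}\equiv\infty$ and $I_1=d$, so that the bounds in (a) are trivial.) For $t>0$ let $\ell(t)=(t-\ln t-1)+t(e^t-1)^{-1}+\ln(1-e^{-t})$, and let $\ell^*(x)=\sup_{t>0}(xt-\ell(t))\in[0,\infty]$ for $x\geq 0$. Let $\varepsilon'$ and $X_1'$ be independent copies of $\varepsilon$ and $X_1$, and let $\|\cdot\|_\infty$ of a nonnegative random variable denote its essential supremum. **Proposition.** Assume that $\|\delta(\varepsilon,\varepsilon')\|_\infty\le T_1$ for a constant $T_1>0$, and let $$V_n^2=\sum_{k=2}^nK_{k,n}^2(\tau_kT_1+\xi_k)^2,\qquad D_n=\sum_{k=2}^nK_{k,n}(\tau_kT_1+\xi_k).$$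 (a) For all $n\ge2$ and $x\in[0,2D_n]$, $$\mathbb P\big(\|S_n\|_p\ge d^{1/p}x\big)\le I_1(x)+2d\exp\Big\{-\frac{D_n^2}{V_n^2}\,\ell^*\Big(\frac{x}{2D_n}\Big)\Big\},$$ and consequently $$\mathbb P\big(\|S_n\|_p\ge d^{1/p}x\big)\le I_1(x)+2d\Big(\frac{D_n-x/2}{D_n}\Big)^{\frac{D_nx-(x/2)^2}{V_n^2}}\le I_1(x)+2d\exp\Big\{-\frac{x^2}{2V_n^2}\Big\}$$ (with $d^{1/\infty}=1$ and $e^{-\infty}=0$; if $D_n=0$, so that $x=0$, quotients by zero are read as $0$ and $0^0=1$). (b) Assume moreover that $\|d(X_1,X_1')\|_\infty<\infty$, and let $\rho\in(0,1)$, $\eta\in(0,\infty)$ and $\alpha$ be constants. There is a constant $c>0$, depending only on $p,d,\alpha,\rho,\eta,T_1$ (not on $x$, $n$, $f_n$ or the chain), such that for every $x>0$ (with $\ln0=-\infty$): [i] if $\alpha\in[0,1)$ and $\rho_n\le1-\rho/n^\alpha$, $\max\{\xi_n,\tau_n\}\le\eta/n^\alpha$ for all $n\ge2$, then $$\limsup_{n\to\infty}\frac1n\ln\mathbb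 P(\|S_n\|_p\ge nx)\le-c\,x^2;$$ [ii] if $\alpha\in(0,1/2)$ and $\rho_n\le1-\rho/n^\alpha$, $\max\{\xi_n,\tau_n\}\le\eta$ for all $n\ge2$, then $$\limsup_{n\to\infty}\frac1{n^{1-2\alpha}}\ln\mathbb P(\|S_n\|_p\ge nx)\le-c\,x^2;$$ [iii] if $\rho_n\le\rho$ and $\max\{\xi_n,\tau_n\}\le\eta/n^\alpha$ for all $n\ge2$, then $$\limsup_{n\to\infty}\frac1{n^{1+2\alpha}}\ln\mathbb P(\|S_n\|_p\ge nx)\le-c\,x^2\quad\text{if }0<\alpha<\tfrac12,$$ $$\limsup_{n\to\infty}\frac{\ln n}{n^2}\ln\mathbb P(\|S_n\|_p\ge nx)\le-c\,x^2\quad\text{if }\alpha=\tfrac12,$$ $$\limsup_{n\to\infty}\frac1{n^2}\ln\mathbb P(\|S_n\|_p\ge nx)\le-c\,x^2\quad\text{if }\tfrac12<\alpha<1.$$ -/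

import Mathlib

open MeasureTheory ProbabilityTheory Filter
open scoped ENNReal

universe u v w

/-- A non-homogeneous chain `X (n+1) = F (n+1) (X n) (ε (n+1))`, `n ≥ 1`, driven by an i.i.d. sequence
`ε 1, ε 2, …` that is independent of the initial state from `ε 2` on, where `F n` (`n ≥ 2`) contracts in mean
with rate `ρ n` and is `(τ n, ξ n)`-regular in the noise.
The values at the indices not mentioned (such as `X 0`, `ε 0`, `F 1`) are arbitrary and irrelevant. -/
structure IteratedChain (𝒳 𝒴 Ω : Type*) [MetricSpace 𝒳] [MeasurableSpace 𝒳]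
    [MetricSpace 𝒴] [MeasurableSpace 𝒴] [MeasurableSpace Ω] (P : Measure Ω) where
  /-- the iterated maps -/
  F : ℕ → 𝒳 → 𝒴 → 𝒳
  /-- the noise -/
  ε : ℕ → Ω → 𝒴
  /-- the chain -/
  X : ℕ → Ω → 𝒳
  ρ : ℕ → ℝ
  τ : ℕ → ℝ
  ξ : ℕ → ℝ
  measurable_F : ∀ n, 2 ≤ n → Measurable (Function.uncurry (F n))
  measurable_ε : ∀ n, 1 ≤ n → Measurable (ε n)
  measurable_X_one : Measurable (X 1)
  indep_ε : iIndepFun (fun i : ℕ => ε (i + 1)) P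
  identDistrib_ε : ∀ n, 1 ≤ n → IdentDistrib (ε n) (ε 1) P P
  indep_X_one : IndepFun (X 1) (fun ω (i : ℕ) => ε (i + 2) ω) P
  step : ∀ n, 1 ≤ n → ∀ ω, X (n + 1) ω = F (n + 1) (X n ω) (ε (n + 1) ω)
  ρ_nonneg : ∀ n, 2 ≤ n → 0 ≤ ρ n
  ρ_lt_one : ∀ n, 2 ≤ n → ρ n < 1
  τ_nonneg : ∀ n, 2 ≤ n → 0 ≤ τ n
  ξ_nonneg : ∀ n, 2 ≤ n → 0 ≤ ξ n
  contract : ∀ n, 2 ≤ n → ∀ x x' : 𝒳,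
    ∫⁻ ω, edist (F n x (ε 1 ω)) (F n x' (ε 1 ω)) ∂P ≤ ENNReal.ofReal (ρ n) * edist x x'
  noise_regular : ∀ n, 2 ≤ n → ∀ (x : 𝒳) (y y' : 𝒴),
    dist (F n x y) (F n x y') ≤ τ n * dist y y' + ξ n

/-- `f` is separately Lipschitz with constants one, with respect to the `ℓ^p` norm on `ℝ^d`. -/
def SeparatelyLipschitz {𝒳 : Type*} [MetricSpace 𝒳] {n d : ℕ} {p : ℝ≥0∞} [Fact (1 ≤ p)]
    (f : (Fin n → 𝒳) → PiLp p (fun _ : Fin d => ℝ)) : Prop :=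
  ∀ x x' : Fin n → 𝒳, ‖f x - f x'‖ ≤ ∑ i, dist (x i) (x' i)

/-- `‖dist (Z, Z')‖_∞` for a random variable `Z` and an independent copy `Z'` of `Z`. -/
noncomputable def essDiam {Z Ω : Type*} [MetricSpace Z] [MeasurableSpace Z] [MeasurableSpace Ω]
    (P : Measure Ω) (V : Ω → Z) : ℝ≥0∞ :=
  essSup (fun z : Z × Z => edist z.1 z.2) ((P.map V).prod (P.map V))

namespace IteratedChain

variable {𝒳 𝒴 Ω : Type*} [MetricSpace 𝒳] [MeasurableSpace 𝒳]
    [MetricSpace 𝒴] [MeasurableSpace 𝒴] [MeasurableSpace Ω] {P : Measure Ω}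

/-- `S_n = f (X_1, …, X_n) - 𝔼 [f (X_1, …, X_n)]`. -/
noncomputable def S (C : IteratedChain 𝒳 𝒴 Ω P) {n d : ℕ} {p : ℝ≥0∞} [Fact (1 ≤ p)]
    (f : (Fin n → 𝒳) → PiLp p (fun _ : Fin d => ℝ)) (ω : Ω) : PiLp p (fun _ : Fin d => ℝ) :=
  f (fun i => C.X (i + 1) ω) - ∫ ω', f (fun i => C.X (i + 1) ω') ∂P

/-- `K_{k,n} = 1 + ρ_{k+1} + ρ_{k+1} ρ_{k+2} + ⋯ + ρ_{k+1} ⋯ ρ_n`. -/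
noncomputable def K (C : IteratedChain 𝒳 𝒴 Ω P) (k n : ℕ) : ℝ :=
  ∑ j ∈ Finset.Icc k n, ∏ i ∈ Finset.Ioc k j, C.ρ i

/-- `G_{X_1} (x) = 𝔼 [d (x, X_1)]`, with values in `[0, ∞]`. -/
noncomputable def G (C : IteratedChain 𝒳 𝒴 Ω P) (x : 𝒳) : ℝ≥0∞ :=
  ∫⁻ x', edist x x' ∂(P.map (C.X 1))

/-- `I_1 (x) = d ℙ (G_{X_1} (X_1) ≥ x / (2 K_{1,n}))`. -/
noncomputable def I₁ (C : IteratedChain 𝒳 𝒴 Ω P) (d n : ℕ) (x : ℝ) : ℝ≥0∞ :=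
  d * P {ω | ENNReal.ofReal (x / (2 * C.K 1 n)) ≤ C.G (C.X 1 ω)}

/-- `V_n² = ∑_{k=2}^n K_{k,n}² (τ_k T₁ + ξ_k)²`. -/
noncomputable def Vsq (C : IteratedChain 𝒳 𝒴 Ω P) (T₁ : ℝ) (n : ℕ) : ℝ :=
  ∑ k ∈ Finset.Icc 2 n, (C.K k n) ^ 2 * (C.τ k * T₁ + C.ξ k) ^ 2

/-- `D_n = ∑_{k=2}^n K_{k,n} (τ_k T₁ + ξ_k)`. -/
noncomputable def D (C : IteratedChain 𝒳 𝒴 Ω P) (T₁ : ℝ) (n : ℕ) : ℝ :=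
  ∑ k ∈ Finset.Icc 2 n, C.K k n * (C.τ k * T₁ + C.ξ k)

/-- `limsup_{n → ∞} (1 / a_n) ln ℙ (‖S_n‖_p ≥ n x)`, with values in `[-∞, ∞]` and `ln 0 = -∞`. -/
noncomputable def logDeviation (C : IteratedChain 𝒳 𝒴 Ω P) {d : ℕ} {p : ℝ≥0∞} [Fact (1 ≤ p)]
    (f : ∀ n : ℕ, (Fin n → 𝒳) → PiLp p (fun _ : Fin d => ℝ)) (a : ℕ → ℝ) (x : ℝ) : EReal :=
  limsup (fun n : ℕ => ((1 / a n : ℝ) : EReal) *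
    ENNReal.log (P {ω | (n : ℝ) * x ≤ ‖C.S (f n) ω‖})) atTop

/-- `ρ_n ≤ 1 - ρ / n^α` and `max (ξ_n, τ_n) ≤ η / n^α` for all `n ≥ 2`. -/
def VanishingContractionAndNoise (C : IteratedChain 𝒳 𝒴 Ω P) (α ρ η : ℝ) : Prop :=
  ∀ n : ℕ, 2 ≤ n → C.ρ n ≤ 1 - ρ / (n : ℝ) ^ α ∧ max (C.ξ n) (C.τ n) ≤ η / (n : ℝ) ^ α

/-- `ρ_n ≤ 1 - ρ / n^α` and `max (ξ_n, τ_n) ≤ η` for all `n ≥ 2`. -/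
def VanishingContraction (C : IteratedChain 𝒳 𝒴 Ω P) (α ρ η : ℝ) : Prop :=
  ∀ n : ℕ, 2 ≤ n → C.ρ n ≤ 1 - ρ / (n : ℝ) ^ α ∧ max (C.ξ n) (C.τ n) ≤ η

/-- `ρ_n ≤ ρ` and `max (ξ_n, τ_n) ≤ η / n^α` for all `n ≥ 2`. -/
def VanishingNoise (C : IteratedChain 𝒳 𝒴 Ω P) (α ρ η : ℝ) : Prop :=
  ∀ n : ℕ, 2 ≤ n → C.ρ n ≤ ρ ∧ max (C.ξ n) (C.τ n) ≤ η / (n : ℝ) ^ α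

end IteratedChain

/-- Rio's function `ℓ (t) = (t - ln t - 1) + t (e^t - 1)⁻¹ + ln (1 - e^{-t})`, used for `t > 0`. -/
noncomputable def rioEll (t : ℝ) : ℝ :=
  (t - Real.log t - 1) + t * (Real.exp t - 1)⁻¹ + Real.log (1 - Real.exp (-t))

/-- The Young transform `ℓ* (x) = sup_{t > 0} (x t - ℓ (t))`, with values in `[-∞, ∞]`
(it is `∞` for `x ≥ 1`). -/
noncomputable def rioEllStar (x : ℝ) : EReal :=
  ⨆ (t : ℝ) (_ : 0 < t), ((x * t - rioEll t : ℝ) : EReal)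

/-! The proof is a martingale decomposition followed by Chernoff's bound. Integrating out the noise
one step at a time, from the last back to `ε 2`, turns a separately Lipschitz function of the path
into a function `g` of the initial state. By contraction in mean, averaging over the state at time
`k + 1` changes the Lipschitz weight `κ` of the last coordinate into `1 + ρ_{k+1} κ`, which is the
recursion of `K` (`K_eq_one_add`, `lipschitzUpTo_average`). Given the past, the increment at time
`k` has mean zero and, on the support of the noise, lies in an interval of length `Δ_k = K_{k,n}
(τ_k T₁ + ξ_k)`. Its Laplace transform is therefore controlled by Hoeffding's exponent `(tΔ_k)²/8`
and by Rio's exponent `ℓ(tΔ_k)`; `exists_initial_approx` multiplies these bounds along the path.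

The initial part satisfies `|g(X₁) - 𝔼 g(X₁)| ≤ K_{1,n} G(X₁)`. Half of the deviation `x` is
allotted to it, which produces `I₁`, and half to the martingale. A union bound over the `d`
coordinates and both signs gives the factor `2d` (`deviation_le`).

For (a), `ℓ(t)/t` is concave, so Jensen's inequality with weights `Δ_k/D` bounds the sum of the Rio
exponents by `(D²/V²) ℓ(t)` after rescaling `t` (`sum_rioEllZero_le`). Chernoff's bound then yields
`ℓ*`, and the power bound follows from `ℓ*(x) ≥ (x² - 2x) log(1 - x)`
(`exists_rioEll_conjugate_ge`).

For (b), `I₁` vanishes at deviations of order `n` for large `n`, so the Gaussian bound from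
Hoeffding's exponents decides. It remains to bound `V_n²`, which needs `K_{k,n} = O(k^α)` when the
contraction degenerates (`K_le_mul_rpow_add`) and `K_{k,n} ≤ 1/(1 - ρ)` when it does not. -/

/-! ### Rio's function `ℓ` and lower bounds for its conjugate -/

theorem rioEll_eq {t : ℝ} (ht : 0 < t) :
    rioEll t = t / (1 - Real.exp (-t)) - 1 - Real.log (t / (1 - Real.exp (-t))) := by
  have h1 : Real.exp (-t) < 1 := by simpa using ht
  have h2 : 1 < Real.exp t := by simpa using ht
  have h3 : 0 < 1 - Real.exp (-t) := by linarith
  have h4 : 0 < Real.exp t - 1 := by linarith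
  have h5 : t / (1 - Real.exp (-t)) = t + t * (Real.exp t - 1)⁻¹ := by
    rw [div_eq_iff h3.ne', Real.exp_neg]
    field_simp
    ring
  rw [Real.log_div ht.ne' h3.ne', h5, rioEll]
  ring

/-- `ℓ` dominates the centred log-Laplace transforms of the Bernoulli laws. -/
theorem bernoulli_logLaplace_le_rioEll {s : ℝ} (hs : 0 < s) {p : ℝ} (hp : 0 ≤ p) :
    (1 + p * (Real.exp s - 1)) * Real.exp (-(p * s)) ≤ Real.exp (rioEll s) := by
  have h1 : Real.exp (-s) < 1 := by simpa using hs
  have h3 : 0 < 1 - Real.exp (-s) := by linarith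
  have h2 : 0 < Real.exp s - 1 := by simpa using hs
  set A := s / (1 - Real.exp (-s)) with hA
  have hA0 : 0 < A := by positivity
  have hz : 0 < 1 + p * (Real.exp s - 1) := by positivity
  rw [rioEll_eq hs, ← hA, ← Real.log_le_iff_le_exp (by positivity),
    Real.log_mul hz.ne' (Real.exp_pos _).ne', Real.log_exp]
  have hk : (0 : ℝ) < s / (Real.exp s - 1) := by positivity
  -- The tangent to `log` at `(e^s - 1)/s`. The resulting bound for `log (1 + p (e^s - 1)) - p s` no
  -- longer depends on `p`, and equals `ℓ(s)`.
  have key := Real.log_le_sub_one_of_pos (mul_pos hz hk)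
  rw [Real.log_mul hz.ne' hk.ne'] at key
  have h6 : A = s / (Real.exp s - 1) * Real.exp s := by
    rw [hA, Real.exp_neg]; field_simp
  have h7 : Real.log A = Real.log (s / (Real.exp s - 1)) + s := by
    rw [h6, Real.log_mul hk.ne' (Real.exp_pos _).ne', Real.log_exp]
  have h8 : (1 + p * (Real.exp s - 1)) * (s / (Real.exp s - 1)) = A - s + p * s := by
    rw [h6]; field_simp; ring
  rw [h8] at key
  linarith

/-- A lower bound for the conjugate of `ℓ`, obtained by evaluating at `t = m - l`. -/
theorem mul_sub_rioEll_ge {m l x : ℝ} (hl : 0 < l) (hlm : l < m) (hm : 1 ≤ m)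
    (h : l - Real.log l ≤ m - Real.log m) :
    Real.log m + 1 - m * (1 - x) - l * x ≤ x * (m - l) - rioEll (m - l) := by
  have ht : 0 < m - l := by linarith
  have hm0 : 0 < m := by linarith
  set t := m - l with htdef
  have h1 : Real.exp (-t) < 1 := by simpa using ht
  have h3 : 0 < 1 - Real.exp (-t) := by linarith
  -- A rewriting of `h`. It gives `A ≤ m`; as `a - 1 - log a` increases on `[1, ∞)`, `ℓ(t)` is at
  -- most its value at `m`. This avoids solving for the maximiser of `x t - ℓ(t)`.
  have hexp : Real.exp (-t) ≤ l / m := by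
    rw [← Real.le_log_iff_exp_le (by positivity), Real.log_div hl.ne' hm0.ne']
    linarith
  set A := t / (1 - Real.exp (-t)) with hA
  have hAm : A ≤ m := by
    rw [hA, div_le_iff₀ h3]
    have : m * Real.exp (-t) ≤ l := by
      have := mul_le_mul_of_nonneg_left hexp hm0.le
      rwa [mul_div_cancel₀ _ hm0.ne'] at this
    nlinarith
  have hA1 : 1 ≤ A := by
    rw [hA, le_div_iff₀ h3]
    have := Real.add_one_le_exp (-t)
    linarith
  have hA0 : 0 < A := by linarith
  rw [rioEll_eq ht, ← hA]
  have hlog : Real.log m - Real.log A ≤ m - A := by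
    have h9 := Real.log_le_sub_one_of_pos (div_pos hm0 hA0)
    rw [Real.log_div hm0.ne' hA0.ne'] at h9
    have : m / A - 1 ≤ m - A := by
      rw [div_sub_one hA0.ne', div_le_iff₀ hA0]
      nlinarith
    linarith
  have : x * t = x * m - x * l := by rw [htdef]; ring
  nlinarith

/-- Supplies an explicit admissible pair for `mul_sub_rioEll_ge`. The cubic approximates to third
order the reciprocal of the root `l ≤ 1` of `l - log l = (1 + m) - log (1 + m)`. Both sides agree at
`m = 0`, and the derivative of the difference is a quotient of polynomials with nonnegative
coefficients. -/
theorem add_one_inv_sub_log_le {m : ℝ} (hm : 0 ≤ m) :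
    (1 + m + m ^ 2 / 3 + m ^ 3 / 9)⁻¹ - Real.log (1 + m + m ^ 2 / 3 + m ^ 3 / 9)⁻¹
      ≤ (1 + m) - Real.log (1 + m) := by
  have hder : ∀ z ∈ Set.Ici (0 : ℝ), HasDerivAt
      (fun z : ℝ => (1 + z) - Real.log (1 + z) - ((1 + z + z ^ 2 / 3 + z ^ 3 / 9)⁻¹
        + Real.log (1 + z + z ^ 2 / 3 + z ^ 3 / 9)))
      (1 - 1 / (1 + z) - (-(1 + 2 * z / 3 + 3 * z ^ 2 / 9) / (1 + z + z ^ 2 / 3 + z ^ 3 / 9) ^ 2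
        + (1 + 2 * z / 3 + 3 * z ^ 2 / 9) / (1 + z + z ^ 2 / 3 + z ^ 3 / 9))) z := by
    intro z hz
    have hz0 : (0 : ℝ) ≤ z := hz
    have hR : HasDerivAt (fun z : ℝ => 1 + z + z ^ 2 / 3 + z ^ 3 / 9)
        (1 + 2 * z / 3 + 3 * z ^ 2 / 9) z := by
      exact ((((hasDerivAt_id' z).const_add 1).add (((hasDerivAt_id' z).pow 2).div_const 3)).add
        (((hasDerivAt_id' z).pow 3).div_const 9)).congr_deriv (by norm_num)
    have hpos : (0 : ℝ) < 1 + z + z ^ 2 / 3 + z ^ 3 / 9 := by positivity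
    have h1 := (hasDerivAt_id z).const_add 1
    exact (h1.sub (h1.log (by simp only [id]; positivity))).sub
      ((hR.inv hpos.ne').add (hR.log hpos.ne'))
  have hmono : MonotoneOn (fun z : ℝ => (1 + z) - Real.log (1 + z)
      - ((1 + z + z ^ 2 / 3 + z ^ 3 / 9)⁻¹ + Real.log (1 + z + z ^ 2 / 3 + z ^ 3 / 9)))
      (Set.Ici 0) := by
    apply monotoneOn_of_deriv_nonneg (convex_Ici 0)
    · exact fun z hz => (hder z hz).continuousAt.continuousWithinAt
    · exact fun z hz => (hder z (interior_subset hz)).differentiableAt.differentiableWithinAt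
    · intro z hz
      rw [(hder z (interior_subset hz)).deriv]
      have hz0 : (0 : ℝ) ≤ z := interior_subset hz
      have e : 1 - 1 / (1 + z) - (-(1 + 2 * z / 3 + 3 * z ^ 2 / 9)
          / (1 + z + z ^ 2 / 3 + z ^ 3 / 9) ^ 2
          + (1 + 2 * z / 3 + 3 * z ^ 2 / 9) / (1 + z + z ^ 2 / 3 + z ^ 3 / 9))
          = z * (z ^ 3 * (1 / 27) + z ^ 4 * (1 / 9) + z ^ 5 * (1 / 27) + z ^ 6 * (1 / 81)) /
            ((1 + z) * (1 + z + z ^ 2 / 3 + z ^ 3 / 9) ^ 2) := by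
        have : (0 : ℝ) < 1 + z + z ^ 2 / 3 + z ^ 3 / 9 := by positivity
        have : (0 : ℝ) < 9 + 9 * z + 3 * z ^ 2 + z ^ 3 := by positivity
        field_simp
        ring
      rw [e]
      positivity
  have := hmono (Set.self_mem_Ici) (Set.mem_Ici.2 hm) hm
  simp only [Real.log_inv] at this ⊢
  norm_num at this
  linarith

/-- The elementary inequality to which Rio's bound reduces once the witnesses of
`exists_rioEll_conjugate_ge` are inserted. The difference of the two sides vanishes at `0` and is
nondecreasing. -/
theorem neg_log_one_sub_ge {x : ℝ} (hx : x ∈ Set.Ico (0 : ℝ) 1) :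
    x ^ 2 / 2 - x ^ 3 * (1 - x) / 3 + x ^ 4 * (1 - x) ^ 2 / 4
      + 9 * x * (1 - x) / (9 - 9 * x - 6 * x ^ 2 + 11 * x ^ 3 - 6 * x ^ 4 + 3 * x ^ 5 - x ^ 6)
      ≤ - Real.log (1 - x) := by
  have hD : ∀ z ∈ Set.Ico (0 : ℝ) 1,
      0 < 9 - 9 * z - 6 * z ^ 2 + 11 * z ^ 3 - 6 * z ^ 4 + 3 * z ^ 5 - z ^ 6 := by
    rintro z ⟨hz0, hz1⟩
    have h1 : 0 < 1 - z := by linarith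
    have h2 : 0 < 2 - z := by linarith
    have e : 9 - 9 * z - 6 * z ^ 2 + 11 * z ^ 3 - 6 * z ^ 4 + 3 * z ^ 5 - z ^ 6
        = 9 * (1 - z) ^ 3 + 9 * (z * (2 - z)) * (1 - z) ^ 2 + 3 * (z * (2 - z)) ^ 2 * (1 - z)
          + (z * (2 - z)) ^ 3 := by ring
    rw [e]
    positivity
  have hder : ∀ z ∈ Set.Ico (0 : ℝ) 1, HasDerivAt
      (fun z : ℝ => - Real.log (1 - z) - (z ^ 2 / 2 - z ^ 3 * (1 - z) / 3 + z ^ 4 * (1 - z) ^ 2 / 4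
        + 9 * z * (1 - z) /
          (9 - 9 * z - 6 * z ^ 2 + 11 * z ^ 3 - 6 * z ^ 4 + 3 * z ^ 5 - z ^ 6)))
      (1 / (1 - z) - (z - (3 * z ^ 2 - 4 * z ^ 3) / 3 + (4 * z ^ 3 - 10 * z ^ 4 + 6 * z ^ 5) / 4
        + ((9 - 18 * z) * (9 - 9 * z - 6 * z ^ 2 + 11 * z ^ 3 - 6 * z ^ 4 + 3 * z ^ 5 - z ^ 6)
          - 9 * z * (1 - z) * (-9 - 12 * z + 33 * z ^ 2 - 24 * z ^ 3 + 15 * z ^ 4 - 6 * z ^ 5)) /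
          (9 - 9 * z - 6 * z ^ 2 + 11 * z ^ 3 - 6 * z ^ 4 + 3 * z ^ 5 - z ^ 6) ^ 2)) z := by
    intro z hz
    have h1 : 1 - z ≠ 0 := by have := hz.2; intro h; linarith
    have hi := hasDerivAt_id' z
    have hs : HasDerivAt (fun z : ℝ => 1 - z) (-1) z := hi.const_sub 1
    have hden : HasDerivAt
        (fun z : ℝ => 9 - 9 * z - 6 * z ^ 2 + 11 * z ^ 3 - 6 * z ^ 4 + 3 * z ^ 5 - z ^ 6)
        (-9 - 12 * z + 33 * z ^ 2 - 24 * z ^ 3 + 15 * z ^ 4 - 6 * z ^ 5) z := by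
      refine (((((((hi.const_mul 9).const_sub 9).sub ((hi.pow 2).const_mul 6)).add
        ((hi.pow 3).const_mul 11)).sub ((hi.pow 4).const_mul 6)).add
        ((hi.pow 5).const_mul 3)).sub (hi.pow 6)).congr_deriv ?_
      norm_num; ring
    refine ((hs.log h1).neg.sub ((((((hi.pow 2).div_const 2).sub
      (((hi.pow 3).mul hs).div_const 3)).add (((hi.pow 4).mul (hs.pow 2)).div_const 4))).add
      (((hi.const_mul 9).mul hs).div hden (hD z hz).ne'))).congr_deriv ?_
    norm_num
    ring
  have hmono : MonotoneOn (fun z : ℝ => - Real.log (1 - z) - (z ^ 2 / 2 - z ^ 3 * (1 - z) / 3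
      + z ^ 4 * (1 - z) ^ 2 / 4 + 9 * z * (1 - z) /
        (9 - 9 * z - 6 * z ^ 2 + 11 * z ^ 3 - 6 * z ^ 4 + 3 * z ^ 5 - z ^ 6)))
      (Set.Ico 0 1) := by
    apply monotoneOn_of_deriv_nonneg (convex_Ico 0 1)
    · exact fun z hz => (hder z hz).continuousAt.continuousWithinAt
    · exact fun z hz => (hder z (interior_subset hz)).differentiableAt.differentiableWithinAt
    · intro z hz
      have hz' : z ∈ Set.Ico (0 : ℝ) 1 := interior_subset hz
      rw [(hder z hz').deriv]
      have hz0 : 0 ≤ z := hz'.1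
      have h1 : 0 < 1 - z := by have := hz'.2; linarith
      have h2 := hD z hz'
      -- The numerator divided by `z ^ 3` is written in Bernstein form of degree 15; all
      -- coefficients are positive, so it is nonnegative on `[0, 1)`.
      have e : 1 / (1 - z) - (z - (3 * z ^ 2 - 4 * z ^ 3) / 3
        + (4 * z ^ 3 - 10 * z ^ 4 + 6 * z ^ 5) / 4
        + ((9 - 18 * z) * (9 - 9 * z - 6 * z ^ 2 + 11 * z ^ 3 - 6 * z ^ 4 + 3 * z ^ 5 - z ^ 6)
          - 9 * z * (1 - z) * (-9 - 12 * z + 33 * z ^ 2 - 24 * z ^ 3 + 15 * z ^ 4 - 6 * z ^ 5)) /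
          (9 - 9 * z - 6 * z ^ 2 + 11 * z ^ 3 - 6 * z ^ 4 + 3 * z ^ 5 - z ^ 6) ^ 2)
        = z ^ 3 * (72 * (z ^ 0 * (1 - z) ^ 15) + 1845 / 2 * (z ^ 1 * (1 - z) ^ 14) + 5727 * (z ^ 2 * (1 - z) ^ 13)
          + 44183 / 2 * (z ^ 3 * (1 - z) ^ 12) + 58097 * (z ^ 4 * (1 - z) ^ 11) + 109544 * (z ^ 5 * (1 - z) ^ 10)
          + 458171 / 3 * (z ^ 6 * (1 - z) ^ 9) + 961883 / 6 * (z ^ 7 * (1 - z) ^ 8) + 383033 / 3 * (z ^ 8 * (1 - z) ^ 7)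
          + 230915 / 3 * (z ^ 9 * (1 - z) ^ 6) + 104008 / 3 * (z ^ 10 * (1 - z) ^ 5) + 68221 / 6 * (z ^ 11 * (1 - z) ^ 4)
          + 7796 / 3 * (z ^ 12 * (1 - z) ^ 3) + 2303 / 6 * (z ^ 13 * (1 - z) ^ 2) + 95 / 3 * (z ^ 14 * (1 - z) ^ 1)
          + 1 * (z ^ 15 * (1 - z) ^ 0)) /
          ((1 - z) * (9 - 9 * z - 6 * z ^ 2 + 11 * z ^ 3 - 6 * z ^ 4 + 3 * z ^ 5 - z ^ 6) ^ 2) := by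
        generalize hQ : 9 - 9 * z - 6 * z ^ 2 + 11 * z ^ 3 - 6 * z ^ 4 + 3 * z ^ 5 - z ^ 6 = Q
          at h2 ⊢
        field_simp
        rw [← hQ]
        ring
      rw [e]
      positivity
  have := hmono (Set.left_mem_Ico.2 one_pos) hx hx.1
  norm_num at this
  linarith

theorem log_one_add_ge {u : ℝ} (hu : 0 ≤ u) :
    u - u ^ 2 / 2 + u ^ 3 / 3 - u ^ 4 / 4 ≤ Real.log (1 + u) := by
  have hder : ∀ z ∈ Set.Ici (0 : ℝ), HasDerivAt
      (fun z : ℝ => Real.log (1 + z) - (z - z ^ 2 / 2 + z ^ 3 / 3 - z ^ 4 / 4))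
      (1 / (1 + z) - (1 - z + z ^ 2 - z ^ 3)) z := by
    intro z hz
    have hz0 : (0 : ℝ) ≤ z := hz
    have hi := hasDerivAt_id' z
    refine (((hi.const_add 1).log (by positivity)).sub ((((hi.sub ((hi.pow 2).div_const 2)).add
      ((hi.pow 3).div_const 3))).sub ((hi.pow 4).div_const 4))).congr_deriv ?_
    norm_num
  have hmono : MonotoneOn (fun z : ℝ => Real.log (1 + z) - (z - z ^ 2 / 2 + z ^ 3 / 3 - z ^ 4 / 4))
      (Set.Ici 0) := by
    apply monotoneOn_of_deriv_nonneg (convex_Ici 0)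
    · exact fun z hz => (hder z hz).continuousAt.continuousWithinAt
    · exact fun z hz => (hder z (interior_subset hz)).differentiableAt.differentiableWithinAt
    · intro z hz
      have hz0 : (0 : ℝ) ≤ z := interior_subset hz
      rw [(hder z (interior_subset hz)).deriv]
      have e : 1 / (1 + z) - (1 - z + z ^ 2 - z ^ 3) = z ^ 4 / (1 + z) := by
        field_simp; ring
      rw [e]; positivity
  have := hmono (Set.self_mem_Ici) (Set.mem_Ici.2 hu) hu
  norm_num at this
  linarith

/-- Rio's lower bound for the conjugate of `ℓ`. -/
theorem exists_rioEll_conjugate_ge {x : ℝ} (hx0 : 0 < x) (hx1 : x < 1) :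
    ∃ t, 0 < t ∧ (x ^ 2 - 2 * x) * Real.log (1 - x) ≤ x * t - rioEll t := by
  have hy : 0 < 1 - x := by linarith
  have h2 : 0 < 2 - x := by linarith
  -- Chosen so that `(1 + m) (1 - x) = 1 + x (1 - x)`: then `log (1 + m)` splits off `-log (1 - x)`
  -- and leaves `log (1 + u)` with the small `u = x (1 - x)`.
  obtain ⟨m, hm⟩ : ∃ m, m = x * (2 - x) / (1 - x) := ⟨_, rfl⟩
  have hm0 : 0 < m := by rw [hm]; positivity
  obtain ⟨l, hl⟩ : ∃ l, l = (1 + m + m ^ 2 / 3 + m ^ 3 / 9)⁻¹ := ⟨_, rfl⟩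
  have hl0 : 0 < l := by rw [hl]; positivity
  have hl1 : l < 1 := by
    rw [hl]; apply inv_lt_one_of_one_lt₀
    have : 0 < m + m ^ 2 / 3 + m ^ 3 / 9 := by positivity
    linarith
  refine ⟨1 + m - l, by linarith, le_trans ?_
    (mul_sub_rioEll_ge hl0 (by linarith) (by linarith) (hl ▸ add_one_inv_sub_log_le hm0.le))⟩
  have e1 : 1 + m = (1 + x * (1 - x)) / (1 - x) := by
    rw [hm]; field_simp; ring
  have hxy : 0 < x * (1 - x) := by positivity
  have hD : 0 < 9 - 9 * x - 6 * x ^ 2 + 11 * x ^ 3 - 6 * x ^ 4 + 3 * x ^ 5 - x ^ 6 := by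
    have e : 9 - 9 * x - 6 * x ^ 2 + 11 * x ^ 3 - 6 * x ^ 4 + 3 * x ^ 5 - x ^ 6
        = 9 * (1 - x) ^ 3 + 9 * (x * (2 - x)) * (1 - x) ^ 2 + 3 * (x * (2 - x)) ^ 2 * (1 - x)
          + (x * (2 - x)) ^ 3 := by ring
    rw [e]; positivity
  have e2 : l * x = (1 - x) ^ 2 * (9 * x * (1 - x) /
      (9 - 9 * x - 6 * x ^ 2 + 11 * x ^ 3 - 6 * x ^ 4 + 3 * x ^ 5 - x ^ 6)) := by
    have e3 : 1 + m + m ^ 2 / 3 + m ^ 3 / 9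
        = (9 - 9 * x - 6 * x ^ 2 + 11 * x ^ 3 - 6 * x ^ 4 + 3 * x ^ 5 - x ^ 6) /
          (9 * (1 - x) ^ 3) := by
      rw [hm]; field_simp; ring
    rw [hl, e3, inv_div]
    field_simp
  -- What remains is `-(1 - x)² log (1 - x) + log (1 + u) - u - l x ≥ 0` with `u = x (1 - x)`. The
  -- quartic bound for `log (1 + u)`, divided by `(1 - x)²`, gives exactly the polynomial terms of
  -- `neg_log_one_sub_ge`.
  have h3 := mul_le_mul_of_nonneg_left (neg_log_one_sub_ge ⟨hx0.le, hx1⟩) (sq_nonneg (1 - x))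
  have h4 := log_one_add_ge hxy.le
  rw [e2, e1, Real.log_div (by positivity) hy.ne', div_mul_cancel₀ _ hy.ne']
  nlinarith

/-- The conjugate is infinite from `1` on: in `mul_sub_rioEll_ge` the linear terms are then
harmless, and `log (1 + m)` is unbounded. -/
theorem exists_rioEll_conjugate_ge_of_one_le {x : ℝ} (hx : 1 ≤ x) (B : ℝ) :
    ∃ t, 0 < t ∧ B ≤ x * t - rioEll t := by
  have hm0 := Real.exp_pos B
  set m := Real.exp B with hm
  obtain ⟨l, hl⟩ : ∃ l, l = (1 + m + m ^ 2 / 3 + m ^ 3 / 9)⁻¹ := ⟨_, rfl⟩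
  have hl0 : 0 < l := by rw [hl]; positivity
  have hl1 : l < 1 := by
    rw [hl]; apply inv_lt_one_of_one_lt₀
    have : 0 < m + m ^ 2 / 3 + m ^ 3 / 9 := by positivity
    linarith
  refine ⟨1 + m - l, by linarith, le_trans ?_
    (mul_sub_rioEll_ge hl0 (by linarith) (by linarith) (hl ▸ add_one_inv_sub_log_le hm0.le))⟩
  have : B ≤ Real.log (1 + m) := by
    rw [Real.le_log_iff_exp_le (by positivity)]; linarith
  nlinarith [mul_nonneg (sub_nonneg.2 hx) hm0.le, mul_nonneg (sub_nonneg.2 hx) (sub_nonneg.2 hl1.le)]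

/-- This is `-log (1 - x) ≥ 2x/(2 - x)` multiplied by `x (2 - x)`. It makes the power bound at least
as strong as the Gaussian one. -/
theorem two_mul_sq_le_sq_sub_mul_log {x : ℝ} (hx0 : 0 ≤ x) (hx1 : x < 1) :
    2 * x ^ 2 ≤ (x ^ 2 - 2 * x) * Real.log (1 - x) := by
  have hder : ∀ z ∈ Set.Ico (0 : ℝ) 1, HasDerivAt
      (fun z : ℝ => - Real.log (1 - z) - 2 * z / (2 - z))
      (1 / (1 - z) - 4 / (2 - z) ^ 2) z := by
    intro z hz
    have h1 : 1 - z ≠ 0 := by have := hz.2; intro h; linarith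
    have h2 : 2 - z ≠ 0 := by have := hz.2; intro h; linarith
    have hi := hasDerivAt_id' z
    refine (((hi.const_sub 1).log h1).neg.sub
      ((hi.const_mul 2).div (hi.const_sub 2) h2)).congr_deriv ?_
    norm_num
    ring
  have hmono : MonotoneOn (fun z : ℝ => - Real.log (1 - z) - 2 * z / (2 - z)) (Set.Ico 0 1) := by
    apply monotoneOn_of_deriv_nonneg (convex_Ico 0 1)
    · exact fun z hz => (hder z hz).continuousAt.continuousWithinAt
    · exact fun z hz => (hder z (interior_subset hz)).differentiableAt.differentiableWithinAt
    · intro z hz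
      have hz' : z ∈ Set.Ico (0 : ℝ) 1 := interior_subset hz
      rw [(hder z hz').deriv]
      have h1 : 0 < 1 - z := by have := hz'.2; linarith
      have h2 : 0 < 2 - z := by linarith
      have e : 1 / (1 - z) - 4 / (2 - z) ^ 2 = z ^ 2 / ((1 - z) * (2 - z) ^ 2) := by
        field_simp; ring
      rw [e]; positivity
  have := hmono (Set.left_mem_Ico.2 one_pos) ⟨hx0, hx1⟩ hx0
  norm_num at this
  have h2 : 0 < 2 - x := by linarith
  have h3 : 2 * x / (2 - x) * (x * (2 - x)) ≤ - Real.log (1 - x) * (x * (2 - x)) :=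
    mul_le_mul_of_nonneg_right (by linarith) (by positivity)
  have h4 : 2 * x / (2 - x) * (x * (2 - x)) = 2 * x ^ 2 := by field_simp
  nlinarith

/-! ### Concavity of `ℓ(t)/t` and the Jensen step -/

/-- Halving the argument symmetrises the exponentials, so that derivatives can be handled through
`sinh` and `cosh` with `cosh² = sinh² + 1`. -/
theorem rioEll_two_mul {z : ℝ} (hz : 0 < z) :
    rioEll (2 * z) = Real.log (Real.sinh z / z) + z * Real.cosh z / Real.sinh z - 1 := by
  have hs : 0 < Real.sinh z := Real.sinh_pos_iff.2 hz
  have hA : 2 * z / (1 - Real.exp (-(2 * z))) = z * Real.exp z / Real.sinh z := by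
    have h1 : 1 - Real.exp (-(2 * z)) = 2 * Real.sinh z * Real.exp (-z) := by
      rw [Real.sinh_eq, show -(2 * z) = -z + -z by ring, Real.exp_add]
      have : Real.exp z * Real.exp (-z) = 1 := by rw [← Real.exp_add]; simp
      linear_combination -this
    rw [h1, Real.exp_neg]
    field_simp
  rw [rioEll_eq (by positivity), hA, Real.log_div (by positivity) hs.ne',
    Real.log_mul hz.ne' (Real.exp_pos z).ne', Real.log_exp, Real.log_div hs.ne' hz.ne',
    ← Real.cosh_add_sinh]
  field_simp
  ring

/-- The auxiliary function whose positivity gives the concavity of `ℓ (t) / t`. -/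
noncomputable def rioAux (z : ℝ) : ℝ :=
  -2 * Real.log (Real.sinh z / z) - 1 + (Real.sinh z / z)⁻¹ ^ 2
    + 2 * (Real.cosh z * (Real.sinh z / z)⁻¹) * (1 - (Real.sinh z / z)⁻¹ ^ 2)

theorem hasDerivAt_sinh_div {z : ℝ} (hz : 0 < z) :
    HasDerivAt (fun z => Real.sinh z / z) ((Real.cosh z * z - Real.sinh z) / z ^ 2) z :=
  ((Real.hasDerivAt_sinh z).div (hasDerivAt_id' z) hz.ne').congr_deriv (by ring)

/-- The derivative is a positive factor times a sum of squares. With the limit `0` at `0+`, this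
forces `rioAux` to be nonnegative. -/
theorem hasDerivAt_rioAux {z : ℝ} (hz : 0 < z) :
    HasDerivAt rioAux (2 * z ^ 3 / Real.sinh z ^ 4 *
      (((Real.sinh z / z) ^ 2 - 1) ^ 2 + 2 * (Real.sinh z / z - Real.cosh z) ^ 2)) z := by
  have hs : 0 < Real.sinh z := Real.sinh_pos_iff.2 hz
  have hr : 0 < Real.sinh z / z := by positivity
  have h1 := hasDerivAt_sinh_div hz
  have h2 := h1.fun_inv hr.ne'
  have h3 := ((((h1.log hr.ne').const_mul (-2)).sub_const 1).add (h2.pow 2)).add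
    ((((Real.hasDerivAt_cosh z).mul h2).const_mul 2).mul ((h2.pow 2).const_sub 1))
  refine h3.congr_deriv ?_
  have hc : Real.cosh z ^ 2 = Real.sinh z ^ 2 + 1 := Real.cosh_sq z
  simp only [Nat.cast_ofNat, Pi.mul_apply, Pi.pow_apply, Nat.add_one_sub_one, pow_one]
  clear h3 h2 h1
  generalize Real.cosh z = c at *
  generalize Real.sinh z = s at *
  field_simp
  ring_nf
  simp only [hc]
  ring

theorem tendsto_rioAux : Tendsto rioAux (nhdsWithin 0 (Set.Ioi 0)) (nhds 0) := by
  have h1 : Tendsto (fun z => Real.sinh z / z) (nhdsWithin 0 (Set.Ioi 0)) (nhds 1) := by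
    have := (hasDerivAt_iff_tendsto_slope_zero.1 (Real.hasDerivAt_sinh 0)).mono_left
      (nhdsWithin_mono 0 (fun z (hz : 0 < z) => hz.ne'))
    simp only [zero_add, Real.sinh_zero, sub_zero, smul_eq_mul, Real.cosh_zero] at this
    simp only [div_eq_inv_mul]
    exact this
  have h2 : Tendsto Real.cosh (nhdsWithin 0 (Set.Ioi 0)) (nhds 1) := by
    have := (Real.continuous_cosh.tendsto 0).mono_left (nhdsWithin_le_nhds (s := Set.Ioi 0))
    simpa using this
  have h3 := h1.inv₀ one_ne_zero
  have := ((((h1.log one_ne_zero).const_mul (-2)).sub_const 1).add (h3.pow 2)).add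
    (((h2.mul h3).const_mul 2).mul ((h3.pow 2).const_sub 1))
  unfold rioAux
  simpa using this

theorem rioAux_nonneg {z : ℝ} (hz : 0 < z) : 0 ≤ rioAux z := by
  have hmono : MonotoneOn rioAux (Set.Ioi 0) := by
    apply monotoneOn_of_deriv_nonneg (convex_Ioi 0)
    · exact fun z hz => (hasDerivAt_rioAux hz).continuousAt.continuousWithinAt
    · exact fun z hz =>
        (hasDerivAt_rioAux (interior_subset hz)).differentiableAt.differentiableWithinAt
    · intro z hz
      have hz0 : (0 : ℝ) < z := interior_subset hz
      have hs : 0 < Real.sinh z := Real.sinh_pos_iff.2 hz0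
      rw [(hasDerivAt_rioAux hz0).deriv]
      positivity
  refine le_of_tendsto tendsto_rioAux ?_
  filter_upwards [Ioo_mem_nhdsGT hz] with y hy
  exact hmono hy.1 hz hy.2.le

/-- The second derivative is `-rioAux z / z ^ 3`. -/
theorem concaveOn_rioEll_two_mul_div :
    ConcaveOn ℝ (Set.Ioi 0) (fun z : ℝ => rioEll (2 * z) / z) := by
  have hder : ∀ z ∈ Set.Ioi (0 : ℝ), HasDerivAt (fun z : ℝ => rioEll (2 * z) / z)
      ((-Real.log (Real.sinh z / z) + Real.cosh z * (Real.sinh z / z)⁻¹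
        - (Real.sinh z / z)⁻¹ ^ 2) / z ^ 2) z := by
    intro z hz
    have hz0 : (0 : ℝ) < z := hz
    have hs : 0 < Real.sinh z := Real.sinh_pos_iff.2 hz
    have hr : 0 < Real.sinh z / z := by positivity
    have h1 := ((((hasDerivAt_sinh_div hz).log hr.ne').add
      (((hasDerivAt_id' z).mul (Real.hasDerivAt_cosh z)).div
        (Real.hasDerivAt_sinh z) hs.ne')).sub_const 1).div (hasDerivAt_id' z) hz0.ne'
    refine (h1.congr_of_eventuallyEq ?_).congr_deriv ?_
    · filter_upwards [Ioi_mem_nhds hz0] with y hy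
      rw [rioEll_two_mul hy]; rfl
    · have hc : Real.cosh z ^ 2 = Real.sinh z ^ 2 + 1 := Real.cosh_sq z
      simp only [Pi.add_apply, Pi.mul_apply, Pi.div_apply]
      generalize Real.log (Real.sinh z / z) = l at *
      field_simp
      linear_combination (-z ^ 2) * hc
  have hder2 : ∀ z ∈ Set.Ioi (0 : ℝ), HasDerivAt (fun z : ℝ =>
      (-Real.log (Real.sinh z / z) + Real.cosh z * (Real.sinh z / z)⁻¹
        - (Real.sinh z / z)⁻¹ ^ 2) / z ^ 2) (-(rioAux z / z ^ 3)) z := by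
    intro z hz
    have hz0 : (0 : ℝ) < z := hz
    have hs : 0 < Real.sinh z := Real.sinh_pos_iff.2 hz
    have hr : 0 < Real.sinh z / z := by positivity
    have h1 := hasDerivAt_sinh_div hz
    have h2 := h1.fun_inv hr.ne'
    have h3 := ((((h1.log hr.ne').neg).add ((Real.hasDerivAt_cosh z).mul h2)).sub (h2.pow 2)).div
      ((hasDerivAt_id' z).pow 2) (by simpa using hz0.ne')
    refine h3.congr_deriv ?_
    have hc : Real.cosh z ^ 2 = Real.sinh z ^ 2 + 1 := Real.cosh_sq z
    simp only [Pi.add_apply, Pi.mul_apply, Pi.sub_apply, Pi.neg_apply, Pi.pow_apply,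
      rioAux, Nat.cast_ofNat, Nat.add_one_sub_one, pow_one]
    clear h3 h2 h1
    generalize Real.log (Real.sinh z / z) = l at *
    generalize Real.cosh z = c at *
    generalize Real.sinh z = s at *
    field_simp
    ring_nf
    simp only [hc]
    ring
  refine concaveOn_of_hasDerivWithinAt2_nonpos (convex_Ioi 0)
    (f' := fun z => (-Real.log (Real.sinh z / z) + Real.cosh z * (Real.sinh z / z)⁻¹
        - (Real.sinh z / z)⁻¹ ^ 2) / z ^ 2) (f'' := fun z => -(rioAux z / z ^ 3)) ?_ ?_ ?_ ?_
  · exact fun z hz => (hder z hz).continuousAt.continuousWithinAt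
  · exact fun z hz => (hder z (interior_subset hz)).hasDerivWithinAt
  · exact fun z hz => (hder2 z (interior_subset hz)).hasDerivWithinAt
  · intro z hz
    have hz0 : (0 : ℝ) < z := interior_subset hz
    have := rioAux_nonneg hz0
    simp only [Left.neg_nonpos_iff]
    positivity

theorem concaveOn_rioEll_div : ConcaveOn ℝ (Set.Ioi 0) (fun t : ℝ => rioEll t / t) := by
  refine ⟨convex_Ioi 0, fun x hx y hy a b ha hb hab => ?_⟩
  have hx' : (0 : ℝ) < x := hx
  have hy' : (0 : ℝ) < y := hy
  have h := concaveOn_rioEll_two_mul_div.2 (x := x / 2) (y := y / 2) (half_pos hx')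
    (half_pos hy') ha hb hab
  simp only [smul_eq_mul] at h ⊢
  rw [show 2 * (x / 2) = x by ring, show 2 * (y / 2) = y by ring,
    show 2 * (a * (x / 2) + b * (y / 2)) = a * x + b * y by ring,
    show a * (x / 2) + b * (y / 2) = (a * x + b * y) / 2 by ring] at h
  have e : ∀ r s : ℝ, r / (s / 2) = 2 * (r / s) := fun r s => by
    rw [div_div_eq_mul_div]; ring
  rw [e, e, e] at h
  linarith

/-- Extension of `ℓ` by its limit at `0`. -/
noncomputable def rioEllZero (t : ℝ) : ℝ := if t = 0 then 0 else rioEll t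

/-- Jensen's inequality for `ℓ(t)/t` at the points `t D Δ_i / V` with weights `Δ_i / D`, where `D =
∑ Δ_i` and `V = ∑ Δ_i²`; the barycentre is exactly `t`. Indices with `Δ_i = 0` are removed first,
since concavity holds only on `t > 0`. -/
theorem sum_rioEllZero_le {ι : Type*} (s : Finset ι) (Δ : ι → ℝ) (hΔ : ∀ i ∈ s, 0 ≤ Δ i)
    (hD : 0 < ∑ i ∈ s, Δ i) {t : ℝ} (ht : 0 < t) :
    ∑ i ∈ s, rioEllZero (t * (∑ i ∈ s, Δ i) / (∑ i ∈ s, Δ i ^ 2) * Δ i)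
      ≤ (∑ i ∈ s, Δ i) ^ 2 / (∑ i ∈ s, Δ i ^ 2) * rioEll t := by
  classical
  have hV : 0 < ∑ i ∈ s, Δ i ^ 2 := by
    obtain ⟨i, hi, hi0⟩ := Finset.exists_lt_of_sum_lt (s := s) (f := fun _ => (0 : ℝ)) (g := Δ)
      (by simpa using hD)
    exact Finset.sum_pos' (fun i _ => sq_nonneg _) ⟨i, hi, by positivity⟩
  have hDs : ∑ i ∈ s.filter (fun i => Δ i ≠ 0), Δ i = ∑ i ∈ s, Δ i := Finset.sum_filter_ne_zero s
  have hVs : ∑ i ∈ s.filter (fun i => Δ i ≠ 0), Δ i ^ 2 = ∑ i ∈ s, Δ i ^ 2 :=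
    Finset.sum_filter_of_ne (fun i _ h hi => h (by simp [hi]))
  set D := ∑ i ∈ s, Δ i with hDdef
  set V := ∑ i ∈ s, Δ i ^ 2 with hVdef
  clear_value D V
  have hpos : ∀ i ∈ s.filter (fun i => Δ i ≠ 0), 0 < Δ i := fun i hi => by
    rw [Finset.mem_filter] at hi
    exact lt_of_le_of_ne (hΔ i hi.1) (Ne.symm hi.2)
  have hJ := ConcaveOn.le_map_sum concaveOn_rioEll_div (t := s.filter (fun i => Δ i ≠ 0))
    (w := fun i => Δ i / D) (p := fun i => t * D / V * Δ i)
    (fun i hi => (div_pos (hpos i hi) hD).le) (by rw [← Finset.sum_div, hDs, div_self hD.ne'])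
    (fun i hi => by have := hpos i hi; exact (by positivity : 0 < t * D / V * Δ i))
  have e1 : ∑ i ∈ s.filter (fun i => Δ i ≠ 0), Δ i / D * (t * D / V * Δ i) = t := by
    have : ∀ i, Δ i / D * (t * D / V * Δ i) = t / V * Δ i ^ 2 := fun i => by field_simp
    simp_rw [this]
    rw [← Finset.mul_sum, hVs]
    field_simp
  simp only [smul_eq_mul] at hJ
  rw [e1] at hJ
  have e2 : ∑ i ∈ s.filter (fun i => Δ i ≠ 0),
      Δ i / D * (rioEll (t * D / V * Δ i) / (t * D / V * Δ i))
      = V / (t * D ^ 2) * ∑ i ∈ s, rioEllZero (t * D / V * Δ i) := by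
    have e0 : ∑ i ∈ s.filter (fun i => Δ i ≠ 0), rioEllZero (t * D / V * Δ i)
        = ∑ i ∈ s, rioEllZero (t * D / V * Δ i) :=
      Finset.sum_filter_of_ne fun i _ h hi => h (by rw [hi, mul_zero, rioEllZero, if_pos rfl])
    rw [← e0, Finset.mul_sum]
    refine Finset.sum_congr rfl fun i hi => ?_
    have h0 := hpos i hi
    have : t * D / V * Δ i ≠ 0 := by positivity
    rw [rioEllZero, if_neg this]
    generalize rioEll (t * D / V * Δ i) = r
    field_simp
  rw [e2] at hJ
  have hk : (0 : ℝ) < t * D ^ 2 / V := by positivity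
  have := mul_le_mul_of_nonneg_left hJ hk.le
  have e3 : t * D ^ 2 / V * (V / (t * D ^ 2) * ∑ i ∈ s, rioEllZero (t * D / V * Δ i))
      = ∑ i ∈ s, rioEllZero (t * D / V * Δ i) := by field_simp
  have e4 : t * D ^ 2 / V * (rioEll t / t) = D ^ 2 / V * rioEll t := by field_simp
  rwa [e3, e4] at this

/-! ### Laplace transform of one bounded increment -/

/-- A law of bounded essential diameter is carried by a set of bounded diameter. -/
theorem dist_le_of_mem_support {𝒴 : Type*} [MetricSpace 𝒴] [TopologicalSpace.SeparableSpace 𝒴]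
    [MeasurableSpace 𝒴] [BorelSpace 𝒴] (μ : Measure 𝒴) [IsProbabilityMeasure μ] {T : ℝ≥0∞}
    (hT : essSup (fun z : 𝒴 × 𝒴 => edist z.1 z.2) (μ.prod μ) ≤ T)
    {y y' : 𝒴} (hy : y ∈ μ.support) (hy' : y' ∈ μ.support) : edist y y' ≤ T := by
  by_contra! h
  have hU : IsOpen {z : 𝒴 × 𝒴 | T < edist z.1 z.2} := isOpen_lt continuous_const continuous_edist
  obtain ⟨a, ha, b, hb, hab⟩ := mem_nhds_prod_iff.1 (hU.mem_nhds (show (y, y') ∈ _ from h))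
  have h1 := (μ.mem_support_iff_forall y).1 hy a ha
  have h2 := (μ.mem_support_iff_forall y').1 hy' b hb
  have h3 : (μ.prod μ) (a ×ˢ b) = 0 := by
    refine measure_mono_null hab ?_
    have := ENNReal.ae_le_essSup (μ := μ.prod μ) (fun z : 𝒴 × 𝒴 => edist z.1 z.2)
    rw [ae_iff] at this
    refine measure_mono_null (fun z hz => ?_) this
    exact not_le.2 (hT.trans_lt hz)
  rw [Measure.prod_prod] at h3
  exact mul_ne_zero h1.ne' h2.ne' h3

theorem exists_Icc_of_sub_le {𝒴 : Type*} {h : 𝒴 → ℝ} {s : Set 𝒴} {Δ : ℝ} (hs : s.Nonempty)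
    (hΔ : ∀ y ∈ s, ∀ y' ∈ s, h y - h y' ≤ Δ) :
    ∃ a, ∀ y ∈ s, h y ∈ Set.Icc a (a + Δ) := by
  obtain ⟨y₀, hy₀⟩ := hs
  have hbdd : BddBelow (h '' s) := ⟨h y₀ - Δ, by
    rintro _ ⟨y, hy, rfl⟩; linarith [hΔ y₀ hy₀ y hy]⟩
  refine ⟨sInf (h '' s), fun y hy => ⟨csInf_le hbdd ⟨y, hy, rfl⟩, ?_⟩⟩
  have : h y - Δ ≤ sInf (h '' s) := by
    refine le_csInf ⟨_, y₀, hy₀, rfl⟩ ?_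
    rintro _ ⟨y', hy', rfl⟩; linarith [hΔ y hy y' hy']
  linarith

section OneStep

variable {𝒴 : Type*} [MeasurableSpace 𝒴] {μ : Measure 𝒴} [IsProbabilityMeasure μ]
  {h : 𝒴 → ℝ} {Δ : ℝ}

theorem integrable_of_ae_mem_Icc (hm : Measurable h) {a b : ℝ} (hab : ∀ᵐ y ∂μ, h y ∈ Set.Icc a b) :
    Integrable h μ :=
  Integrable.of_mem_Icc a b hm.aemeasurable hab

/-- On an interval `exp` lies below its chord, which reduces the claim to a two-point law with the
same mean; Rio's `ℓ` dominates all of these. -/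
theorem lintegral_exp_le_rioEllZero_of_pos (hm : Measurable h) {a : ℝ}
    (hab : ∀ᵐ y ∂μ, h y ∈ Set.Icc a (a + Δ)) {t : ℝ} (ht : 0 < t) :
    ∫⁻ y, ENNReal.ofReal (Real.exp (t * (h y - ∫ z, h z ∂μ))) ∂μ
      ≤ ENNReal.ofReal (Real.exp (rioEllZero (t * Δ))) := by
  have hi := integrable_of_ae_mem_Icc hm hab
  have hΔ : 0 ≤ Δ := by
    obtain ⟨y, hy⟩ := hab.exists
    linarith [hy.1, hy.2]
  rcases hΔ.eq_or_lt with rfl | hΔ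
  · have hc : ∀ᵐ y ∂μ, h y = a := hab.mono fun y hy => le_antisymm (by simpa using hy.2) hy.1
    have hint : ∫ z, h z ∂μ = a := by rw [integral_congr_ae hc]; simp
    rw [hint, lintegral_congr_ae (hc.mono fun y hy => by rw [hy])]
    simp [rioEllZero]
  have hs : 0 < t * Δ := by positivity
  set m := ∫ z, h z ∂μ with hmdef
  have ham : a ≤ m := by
    have := integral_mono_ae (integrable_const a) hi (hab.mono fun y hy => hy.1)
    simpa using this
  have hE : 0 < Real.exp (t * Δ) - 1 := by simpa using hs
  have hpt : ∀ᵐ y ∂μ, Real.exp (t * (h y - m)) ≤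
      (1 + (h y - a) / Δ * (Real.exp (t * Δ) - 1)) * Real.exp (-(t * (m - a))) := by
    filter_upwards [hab] with y hy
    have hw0 : 0 ≤ (h y - a) / Δ := div_nonneg (by linarith [hy.1]) hΔ.le
    have hw1 : (h y - a) / Δ ≤ 1 := by rw [div_le_one hΔ]; linarith [hy.2]
    have hc := convexOn_exp.2 (Set.mem_univ 0) (Set.mem_univ (t * Δ)) (sub_nonneg.2 hw1) hw0
      (by ring)
    simp only [smul_eq_mul, mul_zero, zero_add, Real.exp_zero, mul_one] at hc
    rw [show (h y - a) / Δ * (t * Δ) = t * (h y - a) by field_simp] at hc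
    rw [show t * (h y - m) = t * (h y - a) + -(t * (m - a)) by ring, Real.exp_add]
    refine mul_le_mul_of_nonneg_right ?_ (Real.exp_pos _).le
    linarith
  have hgi : Integrable (fun y => (1 + (h y - a) / Δ * (Real.exp (t * Δ) - 1))
      * Real.exp (-(t * (m - a)))) μ := by
    fun_prop
  calc ∫⁻ y, ENNReal.ofReal (Real.exp (t * (h y - m))) ∂μ
      ≤ ∫⁻ y, ENNReal.ofReal ((1 + (h y - a) / Δ * (Real.exp (t * Δ) - 1))
          * Real.exp (-(t * (m - a)))) ∂μ :=
        lintegral_mono_ae (hpt.mono fun y hy => ENNReal.ofReal_le_ofReal hy)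
    _ = ENNReal.ofReal (∫ y, (1 + (h y - a) / Δ * (Real.exp (t * Δ) - 1))
          * Real.exp (-(t * (m - a))) ∂μ) :=
        (ofReal_integral_eq_lintegral_ofReal hgi
          (hpt.mono fun y hy => (Real.exp_pos _).le.trans hy)).symm
    _ ≤ _ := by
        refine ENNReal.ofReal_le_ofReal ?_
        have : ∫ y, (1 + (h y - a) / Δ * (Real.exp (t * Δ) - 1)) * Real.exp (-(t * (m - a))) ∂μ
            = (1 + (m - a) / Δ * (Real.exp (t * Δ) - 1)) * Real.exp (-((m - a) / Δ * (t * Δ))) := by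
          rw [integral_mul_const, integral_add (by fun_prop) (by fun_prop), integral_mul_const,
            integral_div, integral_sub hi (by fun_prop)]
          simp only [integral_const, probReal_univ, smul_eq_mul, one_mul, mul_one]
          rw [show (m - a) / Δ * (t * Δ) = t * (m - a) by field_simp]
        rw [this, rioEllZero, if_neg hs.ne']
        exact bernoulli_logLaplace_le_rioEll hs (div_nonneg (by linarith) hΔ.le)

theorem lintegral_exp_le_sq_div_eight (hm : Measurable h) {a : ℝ}
    (hab : ∀ᵐ y ∂μ, h y ∈ Set.Icc a (a + Δ)) (t : ℝ) :
    ∫⁻ y, ENNReal.ofReal (Real.exp (t * (h y - ∫ z, h z ∂μ))) ∂μ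
      ≤ ENNReal.ofReal (Real.exp ((t * Δ) ^ 2 / 8)) := by
  have hsg := hasSubgaussianMGF_of_mem_Icc hm.aemeasurable hab
  rw [← ofReal_integral_eq_lintegral_ofReal (hsg.integrable_exp_mul t)
    (ae_of_all _ fun y => (Real.exp_pos _).le)]
  refine ENNReal.ofReal_le_ofReal ((hsg.mgf_le t).trans (Real.exp_le_exp.2 (le_of_eq ?_)))
  simp only [add_sub_cancel_left, NNReal.coe_pow, NNReal.coe_div, coe_nnnorm, Real.norm_eq_abs,
    NNReal.coe_ofNat]
  rw [div_pow, sq_abs]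
  ring

/-- The one-step Laplace transform bound: Rio's and Hoeffding's inequalities together. -/
theorem lintegral_exp_le_min (hm : Measurable h) {a : ℝ}
    (hab : ∀ᵐ y ∂μ, h y ∈ Set.Icc a (a + Δ)) (t : ℝ) :
    ∫⁻ y, ENNReal.ofReal (Real.exp (t * (h y - ∫ z, h z ∂μ))) ∂μ
      ≤ ENNReal.ofReal (Real.exp (min (rioEllZero (|t| * Δ)) ((t * Δ) ^ 2 / 8))) := by
  rcases min_choice (rioEllZero (|t| * Δ)) ((t * Δ) ^ 2 / 8) with h1 | h1 <;> rw [h1]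
  · rcases lt_trichotomy t 0 with ht | rfl | ht
    · have := lintegral_exp_le_rioEllZero_of_pos (h := fun y => -h y) (Δ := Δ) (a := -(a + Δ))
        (μ := μ) hm.neg
        (hab.mono fun y hy => ⟨by linarith [hy.2], by linarith [hy.1]⟩) (neg_pos.2 ht)
      rw [integral_neg] at this
      rw [abs_of_neg ht]
      convert this using 5
      ring
    · simp [rioEllZero]
    · rw [abs_of_pos ht]
      exact lintegral_exp_le_rioEllZero_of_pos hm hab ht
  · exact lintegral_exp_le_sq_div_eight hm hab t

end OneStep

/-! ### Independence, path functionals and paths of the chain -/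

theorem indepFun_prodMk_left_of_indepFun_prodMk_right {Ω α β γ : Type*} [MeasurableSpace Ω]
    [MeasurableSpace α] [MeasurableSpace β] [MeasurableSpace γ] {P : Measure Ω}
    [IsProbabilityMeasure P] {A : Ω → α} {B : Ω → β} {D : Ω → γ} (hA : Measurable A)
    (hB : Measurable B) (hD : Measurable D) (h : IndepFun A (fun ω => (B ω, D ω)) P)
    (hBD : IndepFun B D P) : IndepFun (fun ω => (A ω, B ω)) D P := by
  have hAB : IndepFun A B P := h.comp measurable_id measurable_fst
  have := Measure.isProbabilityMeasure_map (μ := P) hA.aemeasurable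
  have := Measure.isProbabilityMeasure_map (μ := P) hB.aemeasurable
  have := Measure.isProbabilityMeasure_map (μ := P) hD.aemeasurable
  rw [indepFun_iff_map_prod_eq_prod_map_map hA.aemeasurable (hB.prodMk hD).aemeasurable,
    (indepFun_iff_map_prod_eq_prod_map_map hB.aemeasurable hD.aemeasurable).1 hBD,
    ← Measure.prodAssoc_prod] at h
  rw [indepFun_iff_map_prod_eq_prod_map_map (hA.prodMk hB).aemeasurable hD.aemeasurable,
    (indepFun_iff_map_prod_eq_prod_map_map hA.aemeasurable hB.aemeasurable).1 hAB]
  have h2 := congrArg (Measure.map MeasurableEquiv.prodAssoc.symm) h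
  rw [Measure.map_map (by fun_prop) (by fun_prop), Measure.map_map (by fun_prop) (by fun_prop)]
    at h2
  simpa [Function.comp_def, MeasurableEquiv.prodAssoc] using h2

theorem indepFun_nat_future {Ω β : Type*} [MeasurableSpace Ω] [MeasurableSpace β]
    {P : Measure Ω} {f : ℕ → Ω → β} (hf : ∀ i, Measurable (f i))
    (h : iIndepFun f P) (m : ℕ) : IndepFun (f m) (fun ω i => f (i + (m + 1)) ω) P := by
  have h1 := indep_iSup_of_disjoint (m := fun i => MeasurableSpace.comap (f i) inferInstance)
    (fun i => (hf i).comap_le) h (S := {m}) (T := Set.Ioi m) (by simp)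
  refine indep_of_indep_of_le_left (indep_of_indep_of_le_right h1 ?_) ?_
  · rw [MeasurableSpace.pi, MeasurableSpace.comap_iSup]
    refine iSup_le fun i => ?_
    rw [MeasurableSpace.comap_comp]
    exact le_iSup₂_of_le (i + (m + 1)) (show m < i + (m + 1) by omega) le_rfl
  · exact le_iSup₂_of_le m rfl le_rfl

/-- Lipschitz in the coordinates `1, …, n` only, with constants one except for the last. -/
def LipschitzUpTo {𝒳 : Type*} [MetricSpace 𝒳] (n : ℕ) (κ : ℝ) (φ : (ℕ → 𝒳) → ℝ) : Prop :=
  ∀ x x' : ℕ → 𝒳, |φ x - φ x'| ≤ ∑ i ∈ Finset.Ico 1 n, dist (x i) (x' i) + κ * dist (x n) (x' n)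

theorem LipschitzUpTo.continuous {𝒳 : Type*} [MetricSpace 𝒳] {n : ℕ} {κ : ℝ} {φ : (ℕ → 𝒳) → ℝ}
    (h : LipschitzUpTo n κ φ) : Continuous φ := by
  refine continuous_iff_continuousAt.2 fun x => tendsto_iff_dist_tendsto_zero.2 ?_
  have hc : Continuous (fun z : ℕ → 𝒳 =>
      ∑ i ∈ Finset.Ico 1 n, dist (z i) (x i) + κ * dist (z n) (x n)) := by fun_prop
  have h0 := hc.tendsto x
  simp only [dist_self, Finset.sum_const_zero, mul_zero, add_zero] at h0
  exact squeeze_zero (fun _ => dist_nonneg) (fun z => h z x) h0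

theorem LipschitzUpTo.eq_of_agree {𝒳 : Type*} [MetricSpace 𝒳] {n : ℕ} {κ : ℝ} {φ : (ℕ → 𝒳) → ℝ}
    (h : LipschitzUpTo n κ φ) (hn : 1 ≤ n) {x x' : ℕ → 𝒳} (hx : ∀ i, 1 ≤ i → i ≤ n → x i = x' i) :
    φ x = φ x' := by
  have h1 := h x x'
  rw [Finset.sum_eq_zero, hx n hn le_rfl, dist_self, mul_zero, add_zero] at h1
  · linarith [abs_nonpos_iff.1 h1]
  · intro i hi
    rw [Finset.mem_Ico] at hi
    rw [hx i hi.1 hi.2.le, dist_self]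

namespace IteratedChain

variable {𝒳 𝒴 Ω : Type*} [MetricSpace 𝒳] [MeasurableSpace 𝒳]
    [MetricSpace 𝒴] [MeasurableSpace 𝒴] [MeasurableSpace Ω] {P : Measure Ω}
    (C : IteratedChain 𝒳 𝒴 Ω P)

theorem K_self (n : ℕ) : C.K n n = 1 := by simp [K]

/-- The backward recursion obeyed by the Lipschitz weight of the last coordinate under averaging. -/
theorem K_eq_one_add {k n : ℕ} (h : k < n) : C.K k n = 1 + C.ρ (k + 1) * C.K (k + 1) n := by
  unfold K
  rw [← Finset.add_sum_Ioc_eq_sum_Icc h.le, Finset.Ioc_self, Finset.prod_empty,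
    ← Finset.Icc_add_one_left_eq_Ioc, Finset.mul_sum]
  congr 1
  refine Finset.sum_congr rfl fun j hj => ?_
  rw [Finset.mem_Icc] at hj
  rw [← Finset.Icc_add_one_left_eq_Ioc, ← Finset.mul_prod_Ioc_eq_prod_Icc hj.1]

theorem one_le_K {k n : ℕ} (hk : 1 ≤ k) (h : k ≤ n) : 1 ≤ C.K k n := by
  induction h using Nat.decreasingInduction with
  | self => rw [K_self]
  | of_succ k hkn ih =>
    rw [C.K_eq_one_add hkn]
    have := C.ρ_nonneg (k + 1) (by omega)
    nlinarith [ih (by omega)]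

theorem measurable_X (m : ℕ) : Measurable (C.X (m + 1)) := by
  induction m with
  | zero => exact C.measurable_X_one
  | succ m ih =>
    have : C.X (m + 1 + 1) = fun ω => Function.uncurry (C.F (m + 2)) (C.X (m + 1) ω, C.ε (m + 2) ω) :=
      funext fun ω => C.step (m + 1) (by omega) ω
    rw [this]
    exact (C.measurable_F (m + 2) (by omega)).comp (ih.prodMk (C.measurable_ε (m + 2) (by omega)))

/-- The path of the chain up to time `n`, continued by its initial value. -/
noncomputable def path (n : ℕ) (ω : Ω) : ℕ → 𝒳 :=
  fun i => if 1 ≤ i ∧ i ≤ n then C.X i ω else C.X 1 ω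

theorem path_apply {n i : ℕ} (h1 : 1 ≤ i) (h2 : i ≤ n) (ω : Ω) : C.path n ω i = C.X i ω :=
  if_pos ⟨h1, h2⟩

theorem path_one (n : ℕ) (ω : Ω) : C.path n ω 1 = C.X 1 ω := by
  unfold path; split_ifs <;> rfl

theorem measurable_path (n : ℕ) : Measurable (C.path n) := by
  refine measurable_pi_iff.2 fun i => ?_
  by_cases h : 1 ≤ i ∧ i ≤ n
  · simp only [path, if_pos h]
    obtain ⟨j, rfl⟩ := Nat.exists_eq_add_of_le' h.1
    exact C.measurable_X j
  · simp only [path, if_neg h]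
    exact C.measurable_X_one

/-- The path `x` with the state at time `n + 1` produced from the noise `y`. -/
noncomputable def extend (n : ℕ) (x : ℕ → 𝒳) (y : 𝒴) : ℕ → 𝒳 :=
  Function.update x (n + 1) (C.F (n + 1) (x n) y)

theorem extend_of_ne {n i : ℕ} (h : i ≠ n + 1) (x : ℕ → 𝒳) (y : 𝒴) : C.extend n x y i = x i :=
  Function.update_of_ne h _ _

theorem extend_self (n : ℕ) (x : ℕ → 𝒳) (y : 𝒴) :
    C.extend n x y (n + 1) = C.F (n + 1) (x n) y := Function.update_self _ _ _

theorem path_succ (m : ℕ) (ω : Ω) :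
    C.path (m + 2) ω = C.extend (m + 1) (C.path (m + 1) ω) (C.ε (m + 2) ω) := by
  funext i
  by_cases hi : i = m + 2
  · subst hi
    rw [C.extend_self, C.path_apply (by omega) le_rfl, C.path_apply (by omega) le_rfl]
    exact C.step (m + 1) (by omega) ω
  · rw [C.extend_of_ne hi]
    unfold path
    congr 1
    apply propext
    omega

theorem measurable_extend (m : ℕ) :
    Measurable (fun z : (ℕ → 𝒳) × 𝒴 => C.extend (m + 1) z.1 z.2) := by
  refine measurable_pi_iff.2 fun i => ?_
  by_cases hi : i = m + 2
  · subst hi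
    simp only [C.extend_self]
    exact Measurable.comp (f := fun z : (ℕ → 𝒳) × 𝒴 => (z.1 (m + 1), z.2))
      (C.measurable_F (m + 2) (by omega)) (by fun_prop)
  · simp only [C.extend_of_ne hi]
    exact (measurable_pi_apply i).comp measurable_fst

/-- The whole future of the noise is kept in the statement so that induction works: the next noise
is moved from the future into the past, by reassociating independence. -/
theorem indepFun_path [IsProbabilityMeasure P] (m : ℕ) :
    IndepFun (C.path (m + 1)) (fun ω (i : ℕ) => C.ε (i + (m + 2)) ω) P := by
  induction m with
  | zero =>
    have : C.path (0 + 1) = (fun x : 𝒳 => fun _ : ℕ => x) ∘ C.X 1 := by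
      funext ω i
      simp only [path, Function.comp]
      split_ifs with h
      · rw [show i = 1 by omega]
      · rfl
    rw [this]
    exact C.indep_X_one.comp (measurable_pi_iff.2 fun _ => measurable_id) measurable_id
  | succ m ih =>
    have hε : ∀ i, Measurable (C.ε (i + 1)) := fun i => C.measurable_ε _ (by omega)
    have hfut : ∀ k, Measurable (fun ω (i : ℕ) => C.ε (i + (k + 1)) ω) := fun k =>
      measurable_pi_iff.2 fun i => hε (i + k)
    have h1 : IndepFun (C.path (m + 1))
        (fun ω => (C.ε (m + 2) ω, fun i : ℕ => C.ε (i + (m + 3)) ω)) P := by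
      have := ih.comp (φ := id) (ψ := fun e : ℕ → 𝒴 => (e 0, fun i : ℕ => e (i + 1))) measurable_id
        (by fun_prop)
      simpa [Function.comp_def, add_assoc, add_comm, add_left_comm] using this
    have h2 : IndepFun (C.ε (m + 2)) (fun ω (i : ℕ) => C.ε (i + (m + 3)) ω) P :=
      indepFun_nat_future hε C.indep_ε (m + 1)
    have h3 := indepFun_prodMk_left_of_indepFun_prodMk_right (C.measurable_path _) (hε (m + 1))
      (hfut (m + 2)) h1 h2
    have h4 := h3.comp (C.measurable_extend m) measurable_id
    have h5 : C.path (m + 1 + 1) = (fun z : (ℕ → 𝒳) × 𝒴 => C.extend (m + 1) z.1 z.2) ∘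
        fun ω => (C.path (m + 1) ω, C.ε (m + 2) ω) := funext fun ω => C.path_succ m ω
    rw [h5]
    exact h4

theorem map_path_prodMk_noise [IsProbabilityMeasure P] (m : ℕ) :
    P.map (fun ω => (C.path (m + 1) ω, C.ε (m + 2) ω))
      = (P.map (C.path (m + 1))).prod (P.map (C.ε 1)) := by
  have h1 : IndepFun (C.path (m + 1)) (C.ε (m + 2)) P := by
    have := (C.indepFun_path m).comp (φ := id) measurable_id (measurable_pi_apply 0)
    simpa [Function.comp_def] using this
  rw [(indepFun_iff_map_prod_eq_prod_map_map (C.measurable_path _).aemeasurable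
    (C.measurable_ε (m + 2) (by omega)).aemeasurable).1 h1,
    (C.identDistrib_ε (m + 2) (by omega)).map_eq]

end IteratedChain

/-! ### Backward averaging and the martingale Laplace transform -/

namespace IteratedChain

variable {𝒳 𝒴 Ω : Type*} [MetricSpace 𝒳] [MeasurableSpace 𝒳]
    [MetricSpace 𝒴] [MeasurableSpace 𝒴] [MeasurableSpace Ω] {P : Measure Ω}
    (C : IteratedChain 𝒳 𝒴 Ω P)

/-- The bound `K_{k,n} (τ_k T + ξ_k)` on the oscillation of the `k`-th martingale increment. -/
noncomputable def osc (T : ℝ) (N k : ℕ) : ℝ := C.K k N * (C.τ k * T + C.ξ k)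

theorem osc_nonneg {T : ℝ} (hT : 0 ≤ T) {N k : ℕ} (hk : 2 ≤ k) (hkN : k ≤ N) : 0 ≤ C.osc T N k :=
  mul_nonneg (zero_le_one.trans (C.one_le_K (by omega) hkN))
    (add_nonneg (mul_nonneg (C.τ_nonneg k hk) hT) (C.ξ_nonneg k hk))

/-- The conditional expectation of `φ` given the path up to time `n`. -/
noncomputable def average (n : ℕ) (φ : (ℕ → 𝒳) → ℝ) (x : ℕ → 𝒳) : ℝ :=
  ∫ y, φ (C.extend n x y) ∂(P.map (C.ε 1))

theorem sub_extend_le {m : ℕ} {κ : ℝ} (hκ : 0 ≤ κ) {φ : (ℕ → 𝒳) → ℝ}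
    (hφ : LipschitzUpTo (m + 2) κ φ) {T : ℝ} (hT : 0 ≤ T) (x : ℕ → 𝒳) {y y' : 𝒴}
    (hy : edist y y' ≤ ENNReal.ofReal T) :
    φ (C.extend (m + 1) x y) - φ (C.extend (m + 1) x y')
      ≤ κ * (C.τ (m + 2) * T + C.ξ (m + 2)) := by
  have h1 := (le_abs_self _).trans (hφ (C.extend (m + 1) x y) (C.extend (m + 1) x y'))
  rw [Finset.sum_eq_zero, zero_add, C.extend_self, C.extend_self] at h1
  · refine h1.trans (mul_le_mul_of_nonneg_left ?_ hκ)
    have hd : dist y y' ≤ T := by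
      rw [edist_dist] at hy
      exact (ENNReal.ofReal_le_ofReal_iff hT).1 hy
    refine (C.noise_regular (m + 2) (by omega) _ y y').trans ?_
    have := mul_le_mul_of_nonneg_left hd (C.τ_nonneg (m + 2) (by omega))
    linarith
  · intro i hi
    rw [Finset.mem_Ico] at hi
    rw [C.extend_of_ne (by omega), C.extend_of_ne (by omega), dist_self]

theorem isProbabilityMeasure_noise [IsProbabilityMeasure P] : IsProbabilityMeasure (P.map (C.ε 1)) :=
  Measure.isProbabilityMeasure_map (C.measurable_ε 1 le_rfl).aemeasurable

theorem exists_Icc_extend [SecondCountableTopology 𝒴] [BorelSpace 𝒴]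
    [IsProbabilityMeasure P] {m : ℕ} {κ : ℝ} (hκ : 0 ≤ κ) {φ : (ℕ → 𝒳) → ℝ}
    (hφ : LipschitzUpTo (m + 2) κ φ) {T : ℝ} (hT : 0 ≤ T)
    (hε : essDiam P (C.ε 1) ≤ ENNReal.ofReal T) (x : ℕ → 𝒳) :
    ∃ a, ∀ y ∈ (P.map (C.ε 1)).support, φ (C.extend (m + 1) x y) ∈
      Set.Icc a (a + κ * (C.τ (m + 2) * T + C.ξ (m + 2))) := by
  have := C.isProbabilityMeasure_noise
  exact exists_Icc_of_sub_le (Measure.nonempty_support (IsProbabilityMeasure.ne_zero _))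
    fun y hy y' hy' => C.sub_extend_le hκ hφ hT x (dist_le_of_mem_support _ hε hy hy')

variable [SecondCountableTopology 𝒳] [BorelSpace 𝒳]

theorem measurable_extend_comp {m : ℕ} {κ : ℝ} {φ : (ℕ → 𝒳) → ℝ}
    (hφ : LipschitzUpTo (m + 2) κ φ) :
    Measurable (fun z : (ℕ → 𝒳) × 𝒴 => φ (C.extend (m + 1) z.1 z.2)) :=
  hφ.continuous.measurable.comp (C.measurable_extend m)

variable [SecondCountableTopology 𝒴] [BorelSpace 𝒴] [IsProbabilityMeasure P]

theorem integrable_extend {m : ℕ} {κ : ℝ} (hκ : 0 ≤ κ) {φ : (ℕ → 𝒳) → ℝ}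
    (hφ : LipschitzUpTo (m + 2) κ φ) {T : ℝ} (hT : 0 ≤ T)
    (hε : essDiam P (C.ε 1) ≤ ENNReal.ofReal T) (x : ℕ → 𝒳) :
    Integrable (fun y => φ (C.extend (m + 1) x y)) (P.map (C.ε 1)) := by
  have := C.isProbabilityMeasure_noise
  obtain ⟨a, ha⟩ := C.exists_Icc_extend hκ hφ hT hε x
  exact integrable_of_ae_mem_Icc ((C.measurable_extend_comp hφ).comp measurable_prodMk_left)
    (Filter.mem_of_superset Measure.support_mem_ae ha)

theorem abs_extend_sub_average_le {m : ℕ} {κ : ℝ} (hκ : 0 ≤ κ) {φ : (ℕ → 𝒳) → ℝ}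
    (hφ : LipschitzUpTo (m + 2) κ φ) {T : ℝ} (hT : 0 ≤ T)
    (hε : essDiam P (C.ε 1) ≤ ENNReal.ofReal T) (x : ℕ → 𝒳) {y : 𝒴}
    (hy : y ∈ (P.map (C.ε 1)).support) :
    |φ (C.extend (m + 1) x y) - C.average (m + 1) φ x|
      ≤ κ * (C.τ (m + 2) * T + C.ξ (m + 2)) := by
  have := C.isProbabilityMeasure_noise
  obtain ⟨a, ha⟩ := C.exists_Icc_extend hκ hφ hT hε x
  have hi := C.integrable_extend hκ hφ hT hε x
  have hae : ∀ᵐ y ∂(P.map (C.ε 1)), φ (C.extend (m + 1) x y) ∈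
      Set.Icc a (a + κ * (C.τ (m + 2) * T + C.ξ (m + 2))) :=
    Filter.mem_of_superset Measure.support_mem_ae ha
  have h1 := integral_mono_ae (integrable_const a) hi (hae.mono fun y hy => hy.1)
  have h2 := integral_mono_ae hi (integrable_const _) (hae.mono fun y hy => hy.2)
  simp only [integral_const, probReal_univ, smul_eq_mul, one_mul] at h1 h2
  have h3 := ha y hy
  rw [average, abs_le]
  constructor <;> linarith [h3.1, h3.2]

/-- Both paths are extended with the same noise `y`. Coordinate `m + 1` then counts once directly
and once through the new state, where contraction in mean contributes `ρ_{m+2} κ`. -/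
theorem lipschitzUpTo_average {m : ℕ} {κ : ℝ} (hκ : 0 ≤ κ) {φ : (ℕ → 𝒳) → ℝ}
    (hφ : LipschitzUpTo (m + 2) κ φ) {T : ℝ} (hT : 0 ≤ T)
    (hε : essDiam P (C.ε 1) ≤ ENNReal.ofReal T) :
    LipschitzUpTo (m + 1) (1 + C.ρ (m + 2) * κ) (C.average (m + 1) φ) := by
  intro x x'
  have := C.isProbabilityMeasure_noise
  have hμ := C.measurable_ε 1 le_rfl
  have hF : ∀ z, Measurable (C.F (m + 2) z) := fun z =>
    (C.measurable_F (m + 2) (by omega)).comp measurable_prodMk_left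
  have hcon : ∫⁻ y, edist (C.F (m + 2) (x (m + 1)) y) (C.F (m + 2) (x' (m + 1)) y) ∂(P.map (C.ε 1))
      ≤ ENNReal.ofReal (C.ρ (m + 2)) * edist (x (m + 1)) (x' (m + 1)) := by
    rw [lintegral_map ((hF _).edist (hF _)) hμ]
    exact C.contract (m + 2) (by omega) _ _
  have hlt : ENNReal.ofReal (C.ρ (m + 2)) * edist (x (m + 1)) (x' (m + 1)) < ⊤ :=
    ENNReal.mul_lt_top ENNReal.ofReal_lt_top (edist_lt_top _ _)
  have hdm : Measurable fun y => dist (C.F (m + 2) (x (m + 1)) y) (C.F (m + 2) (x' (m + 1)) y) :=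
    (hF _).dist (hF _)
  have hdi : Integrable (fun y => dist (C.F (m + 2) (x (m + 1)) y) (C.F (m + 2) (x' (m + 1)) y))
      (P.map (C.ε 1)) := by
    refine ⟨hdm.aestronglyMeasurable, ?_⟩
    rw [hasFiniteIntegral_iff_ofReal (ae_of_all _ fun _ => dist_nonneg)]
    simp only [← edist_dist]
    exact hcon.trans_lt hlt
  have hdint : ∫ y, dist (C.F (m + 2) (x (m + 1)) y) (C.F (m + 2) (x' (m + 1)) y) ∂(P.map (C.ε 1))
      ≤ C.ρ (m + 2) * dist (x (m + 1)) (x' (m + 1)) := by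
    rw [integral_eq_lintegral_of_nonneg_ae (ae_of_all _ fun _ => dist_nonneg)
      hdm.aestronglyMeasurable]
    simp only [← edist_dist]
    refine (ENNReal.toReal_mono hlt.ne hcon).trans (le_of_eq ?_)
    rw [ENNReal.toReal_mul, ENNReal.toReal_ofReal (C.ρ_nonneg (m + 2) (by omega)), ← dist_edist]
  have hi := C.integrable_extend hκ hφ hT hε
  have hpt : ∀ y, |φ (C.extend (m + 1) x y) - φ (C.extend (m + 1) x' y)|
      ≤ ∑ i ∈ Finset.Ico 1 (m + 2), dist (x i) (x' i)
        + κ * dist (C.F (m + 2) (x (m + 1)) y) (C.F (m + 2) (x' (m + 1)) y) := by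
    intro y
    refine (hφ _ _).trans (le_of_eq ?_)
    rw [C.extend_self, C.extend_self]
    congr 1
    refine Finset.sum_congr rfl fun i hi => ?_
    rw [Finset.mem_Ico] at hi
    rw [C.extend_of_ne (by omega), C.extend_of_ne (by omega)]
  calc |C.average (m + 1) φ x - C.average (m + 1) φ x'|
      = |∫ y, (φ (C.extend (m + 1) x y) - φ (C.extend (m + 1) x' y)) ∂(P.map (C.ε 1))| := by
        rw [integral_sub (hi x) (hi x')]; rfl
    _ ≤ ∫ y, |φ (C.extend (m + 1) x y) - φ (C.extend (m + 1) x' y)| ∂(P.map (C.ε 1)) :=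
        abs_integral_le_integral_abs
    _ ≤ ∫ y, (∑ i ∈ Finset.Ico 1 (m + 2), dist (x i) (x' i)
        + κ * dist (C.F (m + 2) (x (m + 1)) y) (C.F (m + 2) (x' (m + 1)) y)) ∂(P.map (C.ε 1)) :=
        integral_mono ((hi x).sub (hi x')).abs ((integrable_const _).add (hdi.const_mul κ)) hpt
    _ = ∑ i ∈ Finset.Ico 1 (m + 2), dist (x i) (x' i) + κ *
        ∫ y, dist (C.F (m + 2) (x (m + 1)) y) (C.F (m + 2) (x' (m + 1)) y) ∂(P.map (C.ε 1)) := by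
        rw [integral_add (integrable_const _) (hdi.const_mul κ), integral_const_mul]
        simp
    _ ≤ ∑ i ∈ Finset.Ico 1 (m + 2), dist (x i) (x' i)
        + κ * (C.ρ (m + 2) * dist (x (m + 1)) (x' (m + 1))) := by gcongr
    _ = _ := by
        rw [Finset.sum_Ico_succ_top (by omega)]
        ring

/-- The Laplace transform bound, with Rio's and Hoeffding's exponents together. -/
noncomputable def exponent (T : ℝ) (N m : ℕ) (t : ℝ) : ℝ :=
  ∑ k ∈ Finset.Icc 2 m, min (rioEllZero (|t| * C.osc T N k)) ((t * C.osc T N k) ^ 2 / 8)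

/-- Backward averaging: up to a function of the initial state, `φ` is a centred martingale with
controlled Laplace transform. -/
theorem exists_initial_approx {T : ℝ} (hT : 0 ≤ T) (hε : essDiam P (C.ε 1) ≤ ENNReal.ofReal T)
    {N : ℕ} (m : ℕ) (hm : m + 1 ≤ N) (φ : (ℕ → 𝒳) → ℝ)
    (hφ : LipschitzUpTo (m + 1) (C.K (m + 1) N) φ) :
    ∃ g : 𝒳 → ℝ, (∀ x x', |g x - g x'| ≤ C.K 1 N * dist x x') ∧
      Integrable (fun ω => φ (C.path (m + 1) ω) - g (C.X 1 ω)) P ∧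
      ∫ ω, (φ (C.path (m + 1) ω) - g (C.X 1 ω)) ∂P = 0 ∧
      ∀ t : ℝ, ∫⁻ ω, ENNReal.ofReal (Real.exp (t * (φ (C.path (m + 1) ω) - g (C.X 1 ω)))) ∂P
        ≤ ENNReal.ofReal (Real.exp (C.exponent T N (m + 1) t)) := by
  induction m generalizing φ with
  | zero =>
    -- With a single time left, `φ` already depends only on the initial state, so `g` is `φ` on
    -- constant sequences.
    have h0 : ∀ ω, φ (C.path (0 + 1) ω) - φ (fun _ => C.X 1 ω) = 0 := fun ω => by
      rw [sub_eq_zero]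
      refine hφ.eq_of_agree (by omega) fun i h1 h2 => ?_
      rw [C.path_apply h1 h2, show i = 1 by omega]
    refine ⟨fun x => φ (fun _ => x), fun x x' => by simpa using hφ (fun _ => x) (fun _ => x'),
      ?_, ?_, fun t => ?_⟩
    · simp only [h0]; exact integrable_const 0
    · simp only [h0, integral_zero]
    · simp only [h0]; simp [exponent]
  | succ m ih =>
    have hprob := C.isProbabilityMeasure_noise
    have hκ : 0 ≤ C.K (m + 2) N := zero_le_one.trans (C.one_le_K (by omega) (by omega))
    have havg := C.lipschitzUpTo_average hκ hφ hT hε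
    obtain ⟨g, hg, hgi, hg0, hgt⟩ := ih (by omega) (C.average (m + 1) φ)
      (by rw [C.K_eq_one_add (by omega)]; exact havg)
    have hgm : Measurable g := by
      refine (continuous_iff_continuousAt.2 fun x => tendsto_iff_dist_tendsto_zero.2 ?_).measurable
      have hc : Continuous fun z => C.K 1 N * dist z x := by fun_prop
      have h0 := hc.tendsto x
      simp only [dist_self, mul_zero] at h0
      exact squeeze_zero (fun _ => dist_nonneg) (fun z => hg z x) h0
    have hφm := C.measurable_extend_comp hφ
    have havm := havg.continuous.measurable
    have hpm := C.measurable_path (m + 1)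
    have hem := C.measurable_ε (m + 2) (by omega)
    have hZ : Measurable (fun ω => (C.path (m + 1) ω, C.ε (m + 2) ω)) := hpm.prodMk hem
    have hmap := C.map_path_prodMk_noise m
    have hpath : ∀ ω, φ (C.path (m + 1 + 1) ω)
        = φ (C.extend (m + 1) (C.path (m + 1) ω) (C.ε (m + 2) ω)) := fun ω => by
      rw [C.path_succ]
    have hpprob : IsProbabilityMeasure (P.map (C.path (m + 1))) :=
      Measure.isProbabilityMeasure_map hpm.aemeasurable
    have hDm : Measurable (fun z : (ℕ → 𝒳) × 𝒴 =>
        φ (C.extend (m + 1) z.1 z.2) - C.average (m + 1) φ z.1) :=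
      hφm.sub (havm.comp measurable_fst)
    -- The increment is bounded because almost every noise value lies in the support. Thus `φ - g`
    -- is integrable without any moment assumption on the initial state.
    have hDi : Integrable (fun z : (ℕ → 𝒳) × 𝒴 =>
        φ (C.extend (m + 1) z.1 z.2) - C.average (m + 1) φ z.1)
        ((P.map (C.path (m + 1))).prod (P.map (C.ε 1))) := by
      refine Integrable.of_bound hDm.aestronglyMeasurable
        (C.K (m + 2) N * (C.τ (m + 2) * T + C.ξ (m + 2))) ?_
      have hs : ∀ᵐ y ∂(P.map (C.ε 1)), y ∈ (P.map (C.ε 1)).support := Measure.support_mem_ae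
      filter_upwards [Measure.quasiMeasurePreserving_snd.ae hs] with z hz
      exact C.abs_extend_sub_average_le hκ hφ hT hε z.1 hz
    have hD0 : ∫ z, (φ (C.extend (m + 1) z.1 z.2) - C.average (m + 1) φ z.1)
        ∂((P.map (C.path (m + 1))).prod (P.map (C.ε 1))) = 0 := by
      rw [integral_prod _ hDi]
      have : ∀ x, ∫ y, (φ (C.extend (m + 1) x y) - C.average (m + 1) φ x) ∂(P.map (C.ε 1)) = 0 :=
        fun x => by
          rw [integral_sub (C.integrable_extend hκ hφ hT hε x) (integrable_const _)]
          simp [average]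
      simp only [this, integral_zero]
    rw [← hmap] at hDi hD0
    rw [integral_map hZ.aemeasurable hDm.aestronglyMeasurable] at hD0
    have hDi' : Integrable (fun ω => φ (C.extend (m + 1) (C.path (m + 1) ω) (C.ε (m + 2) ω))
        - C.average (m + 1) φ (C.path (m + 1) ω)) P := hDi.comp_measurable hZ
    -- The last martingale increment plus the part covered by the induction hypothesis. Only the
    -- former involves the new noise, so Fubini factors the Laplace transform.
    have hdec : ∀ ω, φ (C.path (m + 1 + 1) ω) - g (C.X 1 ω)
        = (φ (C.extend (m + 1) (C.path (m + 1) ω) (C.ε (m + 2) ω))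
          - C.average (m + 1) φ (C.path (m + 1) ω))
          + (C.average (m + 1) φ (C.path (m + 1) ω) - g (C.X 1 ω)) := fun ω => by
      rw [hpath]; ring
    refine ⟨g, hg, ?_, ?_, fun t => ?_⟩
    · simp only [hdec]
      exact hDi'.add hgi
    · simp only [hdec]
      rw [integral_add hDi' hgi, hg0, hD0, add_zero]
    · set c := min (rioEllZero (|t| * C.osc T N (m + 2))) ((t * C.osc T N (m + 2)) ^ 2 / 8) with hc
      have hexp : C.exponent T N (m + 1 + 1) t = C.exponent T N (m + 1) t + c :=
        Finset.sum_Icc_succ_top (by omega) _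
      have hstep : ∀ x, ∫⁻ y, ENNReal.ofReal (Real.exp (t *
          (φ (C.extend (m + 1) x y) - C.average (m + 1) φ x))) ∂(P.map (C.ε 1))
          ≤ ENNReal.ofReal (Real.exp c) := fun x => by
        obtain ⟨a, ha⟩ := C.exists_Icc_extend hκ hφ hT hε x
        exact lintegral_exp_le_min (hφm.comp measurable_prodMk_left)
          (Filter.mem_of_superset Measure.support_mem_ae ha) t
      have hH : Measurable (fun z : (ℕ → 𝒳) × 𝒴 =>
          ENNReal.ofReal (Real.exp (t * (C.average (m + 1) φ z.1 - g (z.1 1)))) *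
          ENNReal.ofReal (Real.exp (t *
            (φ (C.extend (m + 1) z.1 z.2) - C.average (m + 1) φ z.1)))) := by
        have h1 : Measurable fun z : (ℕ → 𝒳) × 𝒴 => C.average (m + 1) φ z.1 :=
          havm.comp measurable_fst
        have h2 : Measurable fun z : (ℕ → 𝒳) × 𝒴 => g (z.1 1) :=
          hgm.comp ((measurable_pi_apply 1).comp measurable_fst)
        exact (((h1.sub h2).const_mul t).exp.ennreal_ofReal).mul
          ((hDm.const_mul t).exp.ennreal_ofReal)
      have hH2 : Measurable (fun x : ℕ → 𝒳 =>
          ENNReal.ofReal (Real.exp (t * (C.average (m + 1) φ x - g (x 1))))) :=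
        (((havm.sub (hgm.comp (measurable_pi_apply 1))).const_mul t).exp.ennreal_ofReal)
      calc ∫⁻ ω, ENNReal.ofReal (Real.exp (t * (φ (C.path (m + 1 + 1) ω) - g (C.X 1 ω)))) ∂P
          = ∫⁻ ω, (fun z : (ℕ → 𝒳) × 𝒴 =>
          ENNReal.ofReal (Real.exp (t * (C.average (m + 1) φ z.1 - g (z.1 1)))) *
          ENNReal.ofReal (Real.exp (t *
            (φ (C.extend (m + 1) z.1 z.2) - C.average (m + 1) φ z.1))))
            (C.path (m + 1) ω, C.ε (m + 2) ω) ∂P := by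
            refine lintegral_congr fun ω => ?_
            simp only
            rw [hdec, C.path_one, ← ENNReal.ofReal_mul (Real.exp_pos _).le, ← Real.exp_add]
            congr 2
            ring
        _ = ∫⁻ x, ∫⁻ y, ENNReal.ofReal (Real.exp (t * (C.average (m + 1) φ x - g (x 1)))) *
              ENNReal.ofReal (Real.exp (t * (φ (C.extend (m + 1) x y) - C.average (m + 1) φ x)))
              ∂(P.map (C.ε 1)) ∂(P.map (C.path (m + 1))) := by
            rw [← lintegral_map hH hZ, hmap, lintegral_prod _ hH.aemeasurable]
        _ ≤ ∫⁻ x, ENNReal.ofReal (Real.exp (t * (C.average (m + 1) φ x - g (x 1)))) *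
              ENNReal.ofReal (Real.exp c) ∂(P.map (C.path (m + 1))) := by
            refine lintegral_mono fun x => ?_
            have hx : Measurable fun y =>
                φ (C.extend (m + 1) x y) - C.average (m + 1) φ x := hDm.comp measurable_prodMk_left
            rw [lintegral_const_mul _ (hx.const_mul t).exp.ennreal_ofReal]
            gcongr
            exact hstep x
        _ = (∫⁻ ω, ENNReal.ofReal (Real.exp (t *
              (C.average (m + 1) φ (C.path (m + 1) ω) - g (C.X 1 ω)))) ∂P) *
              ENNReal.ofReal (Real.exp c) := by
            rw [lintegral_mul_const _ hH2, lintegral_map hH2 hpm]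
            simp only [C.path_one]
        _ ≤ ENNReal.ofReal (Real.exp (C.exponent T N (m + 1) t)) * ENNReal.ofReal (Real.exp c) := by
            gcongr
            exact hgt t
        _ = _ := by
            rw [← ENNReal.ofReal_mul (Real.exp_pos _).le, ← Real.exp_add, hexp]

end IteratedChain

/-! ### Deviation inequalities for fixed `n` -/

theorem meas_ge_le_of_lintegral_exp_le {Ω : Type*} [MeasurableSpace Ω] {P : Measure Ω} {Z : Ω → ℝ}
    (hZ : AEMeasurable Z P) {t : ℝ} (ht : 0 ≤ t) {e : ℝ}
    (h : ∫⁻ ω, ENNReal.ofReal (Real.exp (t * Z ω)) ∂P ≤ ENNReal.ofReal (Real.exp e)) (r : ℝ) :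
    P {ω | r ≤ Z ω} ≤ ENNReal.ofReal (Real.exp (-(t * r) + e)) := by
  have hm := mul_meas_ge_le_lintegral₀ (hZ.const_mul t).exp.ennreal_ofReal
    (ENNReal.ofReal (Real.exp (t * r)))
  have hsub : P {ω | r ≤ Z ω} ≤
      P {ω | ENNReal.ofReal (Real.exp (t * r)) ≤ ENNReal.ofReal (Real.exp (t * Z ω))} :=
    measure_mono fun ω (hω : r ≤ Z ω) => ENNReal.ofReal_le_ofReal
      (Real.exp_le_exp.2 (mul_le_mul_of_nonneg_left hω ht))
  calc P {ω | r ≤ Z ω}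
      = ENNReal.ofReal (Real.exp (-(t * r))) *
        (ENNReal.ofReal (Real.exp (t * r)) * P {ω | r ≤ Z ω}) := by
        rw [← mul_assoc, ← ENNReal.ofReal_mul (Real.exp_pos _).le, ← Real.exp_add]
        simp
    _ ≤ ENNReal.ofReal (Real.exp (-(t * r))) * ENNReal.ofReal (Real.exp e) := by
        gcongr
        exact (mul_le_mul_right hsub _).trans (hm.trans h)
    _ = _ := by rw [← ENNReal.ofReal_mul (Real.exp_pos _).le, ← Real.exp_add]

namespace IteratedChain

variable {𝒳 𝒴 Ω : Type*} [MetricSpace 𝒳] [MeasurableSpace 𝒳]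
    [MetricSpace 𝒴] [MeasurableSpace 𝒴] [MeasurableSpace Ω] {P : Measure Ω}
    (C : IteratedChain 𝒳 𝒴 Ω P)

theorem exponent_neg (T : ℝ) (N m : ℕ) (t : ℝ) : C.exponent T N m (-t) = C.exponent T N m t := by
  simp [exponent]

theorem Vsq_eq (T : ℝ) (n : ℕ) : C.Vsq T n = ∑ k ∈ Finset.Icc 2 n, C.osc T n k ^ 2 := by
  simp [Vsq, osc, mul_pow]

theorem D_eq (T : ℝ) (n : ℕ) : C.D T n = ∑ k ∈ Finset.Icc 2 n, C.osc T n k := rfl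

theorem exponent_le_sq (T : ℝ) (n : ℕ) (t : ℝ) : C.exponent T n n t ≤ t ^ 2 * C.Vsq T n / 8 := by
  rw [Vsq_eq, exponent, Finset.mul_sum, Finset.sum_div]
  exact Finset.sum_le_sum fun k _ => (min_le_right _ _).trans (by rw [mul_pow])

theorem D_nonneg {T : ℝ} (hT : 0 ≤ T) (n : ℕ) : 0 ≤ C.D T n :=
  Finset.sum_nonneg fun k hk => by
    rw [Finset.mem_Icc] at hk
    exact C.osc_nonneg hT hk.1 hk.2

theorem Vsq_pos {T : ℝ} {n : ℕ} (hD : 0 < C.D T n) : 0 < C.Vsq T n := by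
  rw [Vsq_eq]
  obtain ⟨i, hi, hi0⟩ := Finset.exists_lt_of_sum_lt (s := Finset.Icc 2 n) (f := fun _ => (0 : ℝ))
    (g := C.osc T n) (by simpa [D_eq] using hD)
  exact Finset.sum_pos' (fun i _ => sq_nonneg _) ⟨i, hi, by positivity⟩

theorem exponent_le_rioEll {T : ℝ} (hT : 0 ≤ T) {n : ℕ} (hD : 0 < C.D T n) {t : ℝ} (ht : 0 < t) :
    C.exponent T n n (t * C.D T n / C.Vsq T n) ≤ C.D T n ^ 2 / C.Vsq T n * rioEll t := by
  have hV := C.Vsq_pos hD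
  have h := sum_rioEllZero_le (Finset.Icc 2 n) (C.osc T n)
    (fun k hk => by rw [Finset.mem_Icc] at hk; exact C.osc_nonneg hT hk.1 hk.2) hD ht
  rw [← D_eq, ← Vsq_eq] at h
  refine le_trans (Finset.sum_le_sum fun k _ => ?_) h
  rw [abs_of_pos (by positivity)]
  exact min_le_left _ _

variable [SecondCountableTopology 𝒳] [BorelSpace 𝒳] [SecondCountableTopology 𝒴] [BorelSpace 𝒴]
  [IsProbabilityMeasure P]

theorem real_deviation_le {T : ℝ} (hT : 0 ≤ T) (hε : essDiam P (C.ε 1) ≤ ENNReal.ofReal T)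
    {n : ℕ} (hn : 1 ≤ n) {f : (Fin n → 𝒳) → ℝ} (hf : ∀ x x', |f x - f x'| ≤ ∑ i, dist (x i) (x' i))
    {x₀ : 𝒳} (hx₀ : C.G x₀ < ⊤) :
    Integrable (fun ω => f (fun i => C.X (i + 1) ω)) P ∧ ∀ x t : ℝ, 0 ≤ t →
      P {ω | x ≤ |f (fun i => C.X (i + 1) ω) - ∫ ω', f (fun i => C.X (i + 1) ω') ∂P|} ≤
        P {ω | ENNReal.ofReal (x / (2 * C.K 1 n)) ≤ C.G (C.X 1 ω)} +
        ENNReal.ofReal (2 * Real.exp (-(t * (x / 2)) + C.exponent T n n t)) := by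
  obtain ⟨m, rfl⟩ := Nat.exists_eq_add_of_le' hn
  have hK : 0 < C.K 1 (m + 1) := zero_lt_one.trans_le (C.one_le_K le_rfl hn)
  have hφ : LipschitzUpTo (m + 1) (C.K (m + 1) (m + 1))
      (fun z : ℕ → 𝒳 => f (fun i => z (i + 1))) := by
    intro z z'
    refine (hf _ _).trans (le_of_eq ?_)
    rw [C.K_self, one_mul, ← Finset.sum_Ico_succ_top (by omega),
      Fin.sum_univ_eq_sum_range (fun i => dist (z (i + 1)) (z' (i + 1))) (m + 1),
      Finset.sum_Ico_eq_sum_range]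
    simp [add_comm]
  obtain ⟨g, hg, hgi, hg0, hgt⟩ := C.exists_initial_approx hT hε m le_rfl _ hφ
  have hpath : ∀ ω, (fun i : Fin (m + 1) => C.path (m + 1) ω (i + 1))
      = fun i : Fin (m + 1) => C.X (i + 1) ω := fun ω =>
    funext fun i => C.path_apply (by omega) (by omega) ω
  simp only [hpath] at hgi hg0 hgt
  have hX := C.measurable_X_one
  have hPX := Measure.isProbabilityMeasure_map (μ := P) hX.aemeasurable
  have hgc : Continuous g := by
    refine continuous_iff_continuousAt.2 fun x => tendsto_iff_dist_tendsto_zero.2 ?_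
    have hc : Continuous fun z => C.K 1 (m + 1) * dist z x := by fun_prop
    have h0 := hc.tendsto x
    simp only [dist_self, mul_zero] at h0
    exact squeeze_zero (fun _ => dist_nonneg) (fun z => hg z x) h0
  -- By the triangle inequality, finiteness of `G` at one point propagates to all points.
  have hGtop : ∀ x, C.G x < ⊤ := fun x => by
    refine lt_of_le_of_lt (b := ∫⁻ x', (edist x x₀ + edist x₀ x') ∂(P.map (C.X 1)))
      (lintegral_mono fun x' => edist_triangle _ _ _) ?_
    rw [lintegral_add_left measurable_const]
    simp only [lintegral_const, measure_univ, mul_one]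
    exact ENNReal.add_lt_top.2 ⟨edist_lt_top _ _, hx₀⟩
  have hdm : ∀ x : 𝒳, Measurable fun x' => dist x x' := fun x => by fun_prop
  have hdi : ∀ x, Integrable (fun x' => dist x x') (P.map (C.X 1)) := fun x => by
    refine ⟨(hdm x).aestronglyMeasurable, ?_⟩
    rw [hasFiniteIntegral_iff_ofReal (ae_of_all _ fun _ => dist_nonneg)]
    simp only [← edist_dist]
    exact hGtop x
  have hdG : ∀ x, ∫ x', dist x x' ∂(P.map (C.X 1)) = (C.G x).toReal := fun x => by
    rw [integral_eq_lintegral_of_nonneg_ae (ae_of_all _ fun _ => dist_nonneg)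
      (hdm x).aestronglyMeasurable]
    simp only [← edist_dist]
    rfl
  have hgint : Integrable g (P.map (C.X 1)) := by
    refine Integrable.mono' ((integrable_const |g x₀|).add ((hdi x₀).const_mul (C.K 1 (m + 1))))
      hgc.measurable.aestronglyMeasurable (ae_of_all _ fun x => ?_)
    have h1 := hg x x₀
    have h2 := abs_sub_abs_le_abs_sub (g x) (g x₀)
    rw [dist_comm] at h1
    simp only [Real.norm_eq_abs, Pi.add_apply]
    linarith
  have hgX : Integrable (fun ω => g (C.X 1 ω)) P := hgint.comp_measurable hX
  have hfi : Integrable (fun ω => f (fun i => C.X (i + 1) ω)) P := by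
    have := hgi.add hgX
    exact this.congr (ae_of_all _ fun ω => by simp)
  refine ⟨hfi, fun x t ht => ?_⟩
  have hmean : ∫ ω, f (fun i => C.X (i + 1) ω) ∂P = ∫ x', g x' ∂(P.map (C.X 1)) := by
    rw [integral_sub hfi hgX, sub_eq_zero] at hg0
    rw [hg0, integral_map hX.aemeasurable hgc.measurable.aestronglyMeasurable]
  rw [hmean]
  have hinit : ∀ x, |g x - ∫ x', g x' ∂(P.map (C.X 1))| ≤ C.K 1 (m + 1) * (C.G x).toReal := by
    intro x
    have : g x - ∫ x', g x' ∂(P.map (C.X 1)) = ∫ x', (g x - g x') ∂(P.map (C.X 1)) := by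
      rw [integral_sub (integrable_const _) hgint]; simp
    rw [this, ← hdG, ← integral_const_mul]
    exact abs_integral_le_integral_abs.trans
      (integral_mono ((integrable_const _).sub hgint).abs ((hdi x).const_mul _) fun x' => hg x x')
  have hZ := hgi.aestronglyMeasurable.aemeasurable
  have hup := meas_ge_le_of_lintegral_exp_le hZ ht (hgt t) (x / 2)
  have hlo := meas_ge_le_of_lintegral_exp_le hZ.neg ht (e := C.exponent T (m + 1) (m + 1) t)
    (by
      have := hgt (-t)
      rw [exponent_neg] at this
      convert this using 5
      simp only [Pi.neg_apply]
      ring) (x / 2)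
  calc P {ω | x ≤ |f (fun i => C.X (i + 1) ω) - ∫ x', g x' ∂(P.map (C.X 1))|}
      ≤ P ({ω | ENNReal.ofReal (x / (2 * C.K 1 (m + 1))) ≤ C.G (C.X 1 ω)} ∪
          ({ω | x / 2 ≤ f (fun i => C.X (i + 1) ω) - g (C.X 1 ω)} ∪
          {ω | x / 2 ≤ (-fun ω => f (fun i => C.X (i + 1) ω) - g (C.X 1 ω)) ω})) := by
        -- Outside the union the initial part and the martingale part are each below `x / 2`, so
        -- their sum is below `x`.
        refine measure_mono fun ω (hω : x ≤ |_|) => ?_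
        by_contra! hcon
        simp only [Set.mem_union, Set.mem_ofPred_eq, not_or, not_le, Pi.neg_apply] at hcon
        obtain ⟨h1, h2, h3⟩ := hcon
        have h4 : (C.G (C.X 1 ω)).toReal < x / (2 * C.K 1 (m + 1)) := by
          rwa [← ENNReal.ofReal_toReal (hGtop _).ne,
            ENNReal.ofReal_lt_ofReal_iff_of_nonneg ENNReal.toReal_nonneg] at h1
        rw [lt_div_iff₀ (by positivity)] at h4
        have h5 := hinit (C.X 1 ω)
        have h6 : |f (fun i => C.X (i + 1) ω) - g (C.X 1 ω)| < x / 2 := by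
          rw [abs_lt]; constructor <;> linarith
        have h7 := abs_sub_le (f (fun i => C.X (i + 1) ω)) (g (C.X 1 ω))
          (∫ x', g x' ∂(P.map (C.X 1)))
        linarith
    _ ≤ _ := by
        refine (measure_union_le _ _).trans (add_le_add le_rfl ?_)
        refine (measure_union_le _ _).trans ((add_le_add hup hlo).trans (le_of_eq ?_))
        rw [← ENNReal.ofReal_add (Real.exp_pos _).le (Real.exp_pos _).le, ← two_mul]

/-- The exponential deviation inequality in terms of the Laplace exponent. -/
theorem deviation_le {T : ℝ} (hT : 0 ≤ T) (hε : essDiam P (C.ε 1) ≤ ENNReal.ofReal T)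
    {n d : ℕ} (hn : 1 ≤ n) (hd : 1 ≤ d) {p : ℝ≥0∞} [Fact (1 ≤ p)]
    {f : (Fin n → 𝒳) → PiLp p (fun _ : Fin d => ℝ)} (hf : SeparatelyLipschitz f)
    (x : ℝ) {t : ℝ} (ht : 0 ≤ t) :
    P {ω | (d : ℝ) ^ (1 / p).toReal * x ≤ ‖C.S f ω‖} ≤ C.I₁ d n x +
      ENNReal.ofReal (2 * d * Real.exp (-(t * (x / 2)) + C.exponent T n n t)) := by
  -- If `G` is identically infinite, `I₁ = d ≥ 1` and the bound is trivial. Otherwise each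
  -- coordinate is integrable and the mean can be taken coordinatewise.
  by_cases hG : ∀ x₀, C.G x₀ = ⊤
  · have : C.I₁ d n x = d := by simp [I₁, hG]
    rw [this]
    exact prob_le_one.trans (le_add_right (by exact_mod_cast hd))
  push Not at hG
  obtain ⟨x₀, hx₀⟩ := hG
  have hfi : ∀ j, ∀ x x', |f x j - f x' j| ≤ ∑ i, dist (x i) (x' i) := fun j x x' =>
    (PiLp.norm_apply_le (f x - f x') j).trans (hf x x')
  have hdev := fun j => C.real_deviation_le hT hε hn (hfi j) (lt_top_iff_ne_top.2 hx₀)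
  have hS : ∀ ω j, C.S f ω j = f (fun i => C.X (i + 1) ω) j
      - ∫ ω', f (fun i => C.X (i + 1) ω') j ∂P := fun ω j => by
    rw [S, PiLp.sub_apply, eval_integral_piLp fun j => (hdev j).1]
  have hd0 : (0 : ℝ) < d := by exact_mod_cast hd
  calc P {ω | (d : ℝ) ^ (1 / p).toReal * x ≤ ‖C.S f ω‖}
      ≤ P (⋃ j : Fin d, {ω | x ≤ |f (fun i => C.X (i + 1) ω) j
          - ∫ ω', f (fun i => C.X (i + 1) ω') j ∂P|}) := by
        refine measure_mono fun ω (hω : (d : ℝ) ^ (1 / p).toReal * x ≤ ‖C.S f ω‖) => ?_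
        simp only [Set.mem_iUnion, Set.mem_ofPred_eq, ← hS]
        -- This is `‖v‖_p ≤ d^{1/p} ‖v‖_∞`, the source of the factor `d^{1/p}`; some coordinate must
        -- then reach `x`.
        have h1 := (PiLp.antilipschitzWith_ofLp p (fun _ : Fin d => ℝ)).le_mul_dist (C.S f ω) 0
        simp only [dist_zero_right, WithLp.ofLp_zero, Fintype.card_fin, NNReal.coe_rpow,
          NNReal.coe_natCast] at h1
        have h2 : x ≤ ‖WithLp.ofLp (C.S f ω)‖ :=
          le_of_mul_le_mul_left (hω.trans h1) (Real.rpow_pos_of_pos hd0 _)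
        by_contra! hcon
        have hx : 0 < x := (abs_nonneg _).trans_lt (hcon ⟨0, hd⟩)
        exact absurd h2 (not_le.2 ((pi_norm_lt_iff hx).2 hcon))
    _ ≤ ∑ j : Fin d, P {ω | x ≤ |f (fun i => C.X (i + 1) ω) j
          - ∫ ω', f (fun i => C.X (i + 1) ω') j ∂P|} := measure_iUnion_fintype_le _ _
    _ ≤ ∑ _j : Fin d, (P {ω | ENNReal.ofReal (x / (2 * C.K 1 n)) ≤ C.G (C.X 1 ω)} +
        ENNReal.ofReal (2 * Real.exp (-(t * (x / 2)) + C.exponent T n n t))) :=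
        Finset.sum_le_sum fun j _ => (hdev j).2 x t ht
    _ = _ := by
        simp only [Finset.sum_const, Finset.card_univ, Fintype.card_fin, nsmul_eq_mul, mul_add, I₁]
        rw [mul_right_comm, mul_comm (2 * Real.exp _), ENNReal.ofReal_mul hd0.le,
          ENNReal.ofReal_natCast]

end IteratedChain

/-- Passes from a bound for every `t` to the supremum, which may be `∞`. Taking extended logarithms
makes the bound linear in the exponent, so no limit is needed. -/
theorem exp_neg_mul_rioEllStar {q b : ℝ≥0∞} (hb0 : b ≠ 0) (hb : b ≠ ⊤) {c x : ℝ} (hc : 0 < c)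
    (h : ∀ t : ℝ, 0 < t → q ≤ b * ENNReal.ofReal (Real.exp (-(c * (x * t - rioEll t))))) :
    q ≤ b * EReal.exp (-((c : EReal) * rioEllStar x)) := by
  rw [mul_comm, ← ENNReal.div_le_iff hb0 hb]
  have hc' : (0 : EReal) < c := by exact_mod_cast hc
  have h1 : rioEllStar x ≤ -ENNReal.log (q / b) / c := by
    refine iSup₂_le fun t ht => ?_
    rw [EReal.le_div_iff_mul_le hc' (EReal.coe_ne_top c), EReal.le_neg]
    have h2 := h t ht
    rw [mul_comm, ← ENNReal.div_le_iff hb0 hb] at h2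
    refine (ENNReal.log_monotone h2).trans ?_
    rw [ENNReal.log_ofReal_of_pos (Real.exp_pos _), Real.log_exp, mul_comm c, EReal.coe_neg,
      EReal.coe_mul]
  rw [EReal.le_div_iff_mul_le hc' (EReal.coe_ne_top c), EReal.le_neg, mul_comm] at h1
  calc q / b = EReal.exp (ENNReal.log (q / b)) := (ENNReal.exp_log _).symm
    _ ≤ _ := EReal.exp_monotone h1

theorem rpow_one_sub_le {x D V : ℝ} (hx : 0 < x) (hxD : x ≤ 2 * D) (hV : 0 < V) :
    ((D - x / 2) / D) ^ ((D * x - (x / 2) ^ 2) / V) ≤ Real.exp (-(x ^ 2 / (2 * V))) := by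
  have hD : 0 < D := by linarith
  rcases hxD.lt_or_eq with h | rfl
  · have hz1 : x / (2 * D) < 1 := by rw [div_lt_one (by positivity)]; exact h
    have e1 : (D - x / 2) / D = 1 - x / (2 * D) := by field_simp
    rw [e1, Real.rpow_def_of_pos (by linarith)]
    refine Real.exp_le_exp.2 ?_
    have h2 := mul_le_mul_of_nonneg_left (two_mul_sq_le_sq_sub_mul_log (x := x / (2 * D))
      (by positivity) hz1) (by positivity : 0 ≤ D ^ 2 / V)
    have e2 : D ^ 2 / V * (2 * (x / (2 * D)) ^ 2) = x ^ 2 / (2 * V) := by field_simp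
    have e3 : (D * x - (x / 2) ^ 2) / V = -(D ^ 2 / V * ((x / (2 * D)) ^ 2 - 2 * (x / (2 * D)))) := by
      field_simp; ring
    rw [e2] at h2
    rw [e3]
    linarith
  -- At the endpoint the base is `0` and the exponent `D² / V` is nonzero, so the power is `0`.
  · have e1 : (D - 2 * D / 2) / D = 0 := by field_simp; ring
    have e2 : (D * (2 * D) - (2 * D / 2) ^ 2) / V ≠ 0 := by
      have : D * (2 * D) - (2 * D / 2) ^ 2 = D ^ 2 := by ring
      rw [this]; positivity
    rw [e1, Real.zero_rpow e2]
    exact (Real.exp_pos _).le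

namespace IteratedChain

variable {𝒳 𝒴 Ω : Type*} [MetricSpace 𝒳] [MeasurableSpace 𝒳]
    [MetricSpace 𝒴] [MeasurableSpace 𝒴] [MeasurableSpace Ω] {P : Measure Ω}
    (C : IteratedChain 𝒳 𝒴 Ω P)

theorem power_le_gaussian {T : ℝ} {n d : ℕ} {x : ℝ} (hx : x ∈ Set.Icc 0 (2 * C.D T n)) :
    C.I₁ d n x + ENNReal.ofReal (2 * d * ((C.D T n - x / 2) / C.D T n) ^
        ((C.D T n * x - (x / 2) ^ 2) / C.Vsq T n)) ≤
      C.I₁ d n x + ENNReal.ofReal (2 * d * Real.exp (-(x ^ 2 / (2 * C.Vsq T n)))) := by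
  rcases hx.1.eq_or_lt with h0 | h0
  · rw [← h0]; simp
  have := rpow_one_sub_le h0 hx.2 (C.Vsq_pos (by linarith [hx.2]))
  gcongr

variable [SecondCountableTopology 𝒳] [BorelSpace 𝒳] [SecondCountableTopology 𝒴] [BorelSpace 𝒴]
  [IsProbabilityMeasure P]

theorem hoeffding_deviation_le {T : ℝ} (hT : 0 ≤ T) (hε : essDiam P (C.ε 1) ≤ ENNReal.ofReal T)
    {n d : ℕ} (hn : 1 ≤ n) (hd : 1 ≤ d) {p : ℝ≥0∞} [Fact (1 ≤ p)]
    {f : (Fin n → 𝒳) → PiLp p (fun _ : Fin d => ℝ)} (hf : SeparatelyLipschitz f)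
    {x V : ℝ} (hx : 0 ≤ x) (hV : C.Vsq T n ≤ V) (hV0 : 0 < V) :
    P {ω | (d : ℝ) ^ (1 / p).toReal * x ≤ ‖C.S f ω‖} ≤
      C.I₁ d n x + ENNReal.ofReal (2 * d * Real.exp (-(x ^ 2 / (2 * V)))) := by
  -- The minimiser of `-t x / 2 + t² V / 8`.
  refine (C.deviation_le hT hε hn hd hf x (t := 2 * x / V) (by positivity)).trans ?_
  gcongr
  have h1 := C.exponent_le_sq T n (2 * x / V)
  have h2 : (2 * x / V) ^ 2 * C.Vsq T n / 8 ≤ (2 * x / V) ^ 2 * V / 8 := by gcongr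
  have h3 : (2 * x / V) ^ 2 * V / 8 = x ^ 2 / (2 * V) := by field_simp; ring
  have h4 : 2 * x / V * (x / 2) = 2 * (x ^ 2 / (2 * V)) := by field_simp
  linarith

theorem rio_deviation_le {T : ℝ} (hT : 0 ≤ T) (hε : essDiam P (C.ε 1) ≤ ENNReal.ofReal T)
    {n d : ℕ} (hn : 1 ≤ n) (hd : 1 ≤ d) {p : ℝ≥0∞} [Fact (1 ≤ p)]
    {f : (Fin n → 𝒳) → PiLp p (fun _ : Fin d => ℝ)} (hf : SeparatelyLipschitz f)
    (hD : 0 < C.D T n) (x : ℝ) {t : ℝ} (ht : 0 < t) :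
    P {ω | (d : ℝ) ^ (1 / p).toReal * x ≤ ‖C.S f ω‖} ≤
      C.I₁ d n x + ENNReal.ofReal (2 * d * Real.exp
        (-(C.D T n ^ 2 / C.Vsq T n * (x / (2 * C.D T n) * t - rioEll t)))) := by
  have hV := C.Vsq_pos hD
  -- The rescaling for which the Jensen step applies; the exponent becomes `D² / V_n²` times the
  -- expression defining `ℓ*` at `x / (2 D)`.
  refine (C.deviation_le hT hε hn hd hf x (t := t * C.D T n / C.Vsq T n) (by positivity)).trans ?_
  gcongr
  have h1 := C.exponent_le_rioEll hT hD ht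
  have h2 : C.D T n ^ 2 / C.Vsq T n * (x / (2 * C.D T n) * t - rioEll t)
      = t * C.D T n / C.Vsq T n * (x / 2) - C.D T n ^ 2 / C.Vsq T n * rioEll t := by
    field_simp
  linarith

theorem rioEllStar_deviation_le {T : ℝ} (hT : 0 ≤ T) (hε : essDiam P (C.ε 1) ≤ ENNReal.ofReal T)
    {n d : ℕ} (hn : 1 ≤ n) (hd : 1 ≤ d) {p : ℝ≥0∞} [Fact (1 ≤ p)]
    {f : (Fin n → 𝒳) → PiLp p (fun _ : Fin d => ℝ)} (hf : SeparatelyLipschitz f)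
    (x : ℝ) :
    P {ω | (d : ℝ) ^ (1 / p).toReal * x ≤ ‖C.S f ω‖} ≤
      C.I₁ d n x + 2 * d * EReal.exp
        (-(((C.D T n ^ 2 / C.Vsq T n : ℝ) : EReal) * rioEllStar (x / (2 * C.D T n)))) := by
  have hd' : (1 : ℝ≥0∞) ≤ d := by exact_mod_cast hd
  rcases (C.D_nonneg hT n).eq_or_lt with hD | hD
  -- When `D = 0` the coefficient is `0`, hence the exponential is `1` and the right side is at
  -- least `2d`.
  · rw [← hD]
    simp only [ne_eq, OfNat.ofNat_ne_zero, not_false_eq_true, zero_pow, zero_div, EReal.coe_zero,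
      zero_mul, neg_zero, EReal.exp_zero, mul_one]
    refine prob_le_one.trans (le_add_left ?_)
    calc (1 : ℝ≥0∞) ≤ 1 * 1 := by simp
      _ ≤ 2 * d := mul_le_mul' one_le_two hd'
  · rw [← tsub_le_iff_left]
    refine exp_neg_mul_rioEllStar (mul_ne_zero two_ne_zero (zero_lt_one.trans_le hd').ne')
      (ENNReal.mul_ne_top ENNReal.ofNat_ne_top (ENNReal.natCast_ne_top d))
      (div_pos (pow_pos hD 2) (C.Vsq_pos hD)) fun t ht => ?_
    rw [tsub_le_iff_left]
    refine (C.rio_deviation_le hT hε hn hd hf hD x ht).trans (le_of_eq ?_)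
    rw [ENNReal.ofReal_mul (by positivity), ENNReal.ofReal_mul (by positivity),
      ENNReal.ofReal_natCast, ENNReal.ofReal_ofNat]

theorem power_deviation_le {T : ℝ} (hT : 0 ≤ T) (hε : essDiam P (C.ε 1) ≤ ENNReal.ofReal T)
    {n d : ℕ} (hn : 1 ≤ n) (hd : 1 ≤ d) {p : ℝ≥0∞} [Fact (1 ≤ p)]
    {f : (Fin n → 𝒳) → PiLp p (fun _ : Fin d => ℝ)} (hf : SeparatelyLipschitz f)
    {x : ℝ} (hx : x ∈ Set.Icc 0 (2 * C.D T n)) :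
    P {ω | (d : ℝ) ^ (1 / p).toReal * x ≤ ‖C.S f ω‖} ≤
      C.I₁ d n x + ENNReal.ofReal (2 * d * ((C.D T n - x / 2) / C.D T n) ^
        ((C.D T n * x - (x / 2) ^ 2) / C.Vsq T n)) := by
  have hd' : (1 : ℝ) ≤ d := by exact_mod_cast hd
  rcases hx.1.eq_or_lt with h0 | h0
  · refine prob_le_one.trans (le_add_left ?_)
    rw [← h0]
    simp only [mul_zero, zero_div, ne_eq, OfNat.ofNat_ne_zero, not_false_eq_true, zero_pow,
      sub_zero, Real.rpow_zero, mul_one]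
    rw [ENNReal.one_le_ofReal]
    linarith
  have hD : 0 < C.D T n := by linarith [hx.2]
  have hV := C.Vsq_pos hD
  have hc : 0 < C.D T n ^ 2 / C.Vsq T n := by positivity
  have hrio := fun t ht => C.rio_deviation_le hT hε hn hd hf hD x (t := t) ht
  rcases hx.2.lt_or_eq with h1 | h1
  · have hz1 : x / (2 * C.D T n) < 1 := by rw [div_lt_one (by positivity)]; exact h1
    obtain ⟨t, ht, htx⟩ := exists_rioEll_conjugate_ge (by positivity) hz1
    refine (hrio t ht).trans ?_
    gcongr
    have e1 : (C.D T n - x / 2) / C.D T n = 1 - x / (2 * C.D T n) := by field_simp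
    rw [e1, Real.rpow_def_of_pos (by linarith)]
    refine Real.exp_le_exp.2 ?_
    have e3 : (C.D T n * x - (x / 2) ^ 2) / C.Vsq T n = -(C.D T n ^ 2 / C.Vsq T n *
        ((x / (2 * C.D T n)) ^ 2 - 2 * (x / (2 * C.D T n)))) := by
      field_simp; ring
    rw [e3]
    have := mul_le_mul_of_nonneg_left htx hc.le
    linarith
  -- At `x = 2 D` the conjugate is evaluated at `1`, where it is infinite: the probability is at
  -- most `I₁ + δ` for every `δ > 0`, hence at most `I₁`.
  · refine le_add_right ?_
    have hz : x / (2 * C.D T n) = 1 := by rw [h1, div_self (by positivity)]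
    refine ENNReal.le_of_forall_pos_le_add fun δ hδ _ => ?_
    obtain ⟨t, ht, htB⟩ := exists_rioEll_conjugate_ge_of_one_le hz.ge
      (-Real.log (δ / (2 * d)) / (C.D T n ^ 2 / C.Vsq T n))
    refine (hrio t ht).trans (add_le_add le_rfl ?_)
    have hδ' : (0 : ℝ) < δ := hδ
    rw [div_le_iff₀ hc] at htB
    have : Real.exp (-(C.D T n ^ 2 / C.Vsq T n * (x / (2 * C.D T n) * t - rioEll t)))
        ≤ δ / (2 * d) := by
      rw [← Real.le_log_iff_exp_le (by positivity)]
      linarith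
    rw [le_div_iff₀ (by positivity)] at this
    rw [← ENNReal.ofReal_coe_nnreal]
    exact ENNReal.ofReal_le_ofReal (by linarith)

end IteratedChain

/-! ### Growth of power sums, of `K_{k,n}` and of `V_n²` -/

theorem rpow_sub_rpow_sub_one_le {u α : ℝ} (hu : 1 ≤ u) (hα1 : α ≤ 1) :
    u ^ α - u ^ (α - 1) ≤ (u - 1) ^ α := by
  have hu0 : 0 < u := by linarith
  have h1 : (1 - 1 / u) ≤ (1 - 1 / u) ^ α := by
    apply Real.self_le_rpow_of_le_one _ _ hα1
    · rw [sub_nonneg, div_le_one hu0]; exact hu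
    · have : 0 < 1 / u := by positivity
      linarith
  have h2 : (u - 1) ^ α = u ^ α * (1 - 1 / u) ^ α := by
    rw [← Real.mul_rpow hu0.le]
    · congr 1; field_simp
    · rw [sub_nonneg, div_le_one hu0]; exact hu
  rw [h2, Real.rpow_sub_one hu0.ne']
  have h3 : 0 ≤ u ^ α := by positivity
  calc u ^ α - u ^ α / u = u ^ α * (1 - 1 / u) := by ring
    _ ≤ _ := mul_le_mul_of_nonneg_left h1 h3

/-- Induction on `n`; Bernoulli's inequality for the concave power `1 - s` bounds each increment of
`n^{1-s}` from below by `(1 - s) (n + 1)^{-s}`. -/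
theorem sum_Icc_rpow_neg_le {s : ℝ} (hs0 : 0 ≤ s) (hs : s < 1) {n : ℕ} (hn : 1 ≤ n) :
    ∑ k ∈ Finset.Icc 2 n, (k : ℝ) ^ (-s) ≤ (n : ℝ) ^ (1 - s) / (1 - s) := by
  have h1s : 0 < 1 - s := by linarith
  rw [le_div_iff₀ h1s]
  induction n, hn using Nat.le_induction with
  | base => simp
  | succ n hn ih =>
    rw [Finset.sum_Icc_succ_top (by omega), add_mul]
    refine (add_le_add_left ih _).trans ?_
    have hn1 : (1 : ℝ) ≤ ((n + 1 : ℕ) : ℝ) := by push_cast; linarith [(Nat.cast_nonneg n : (0 : ℝ) ≤ n)]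
    have hpos : (0 : ℝ) < ((n + 1 : ℕ) : ℝ) := by linarith
    have hb : 1 + (1 - s) * (-1 / ((n + 1 : ℕ) : ℝ)) ≥ (1 + -1 / ((n + 1 : ℕ) : ℝ)) ^ (1 - s) := by
      refine rpow_one_add_le_one_add_mul_self ?_ h1s.le (by linarith)
      rw [le_div_iff₀ hpos]; linarith
    have h2 : (n : ℝ) ^ (1 - s)
        = ((n + 1 : ℕ) : ℝ) ^ (1 - s) * (1 + -1 / ((n + 1 : ℕ) : ℝ)) ^ (1 - s) := by
      rw [← Real.mul_rpow hpos.le]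
      · congr 1; field_simp; push_cast; ring
      · have : 1 / ((n + 1 : ℕ) : ℝ) ≤ 1 := by rw [div_le_one hpos]; exact hn1
        rw [neg_div]; linarith
    have h3 : ((n + 1 : ℕ) : ℝ) ^ (-s) = ((n + 1 : ℕ) : ℝ) ^ (1 - s) / ((n + 1 : ℕ) : ℝ) := by
      rw [← Real.rpow_sub_one hpos.ne']; congr 1; ring
    rw [h2, h3]
    have h4 : (0 : ℝ) ≤ ((n + 1 : ℕ) : ℝ) ^ (1 - s) := by positivity
    have h5 := mul_le_mul_of_nonneg_left hb h4
    have h6 : ((n + 1 : ℕ) : ℝ) ^ (1 - s) * (1 + (1 - s) * (-1 / ((n + 1 : ℕ) : ℝ)))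
        = ((n + 1 : ℕ) : ℝ) ^ (1 - s) - ((n + 1 : ℕ) : ℝ) ^ (1 - s) / ((n + 1 : ℕ) : ℝ) * (1 - s) := by
      ring
    rw [h6] at h5
    linarith

theorem sum_Icc_inv_le_log {n : ℕ} (hn : 1 ≤ n) :
    ∑ k ∈ Finset.Icc 2 n, (k : ℝ)⁻¹ ≤ Real.log n := by
  have h := harmonic_le_one_add_log n
  rw [harmonic_eq_sum_Icc, ← Finset.add_sum_Ioc_eq_sum_Icc hn,
    ← Finset.Icc_add_one_left_eq_Ioc] at h
  push_cast at h
  norm_num at h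
  linarith

namespace IteratedChain

variable {𝒳 𝒴 Ω : Type*} [MetricSpace 𝒳] [MeasurableSpace 𝒳]
    [MetricSpace 𝒴] [MeasurableSpace 𝒴] [MeasurableSpace Ω] {P : Measure Ω}
    (C : IteratedChain 𝒳 𝒴 Ω P)

theorem K_le_inv {ρ : ℝ} (hρ1 : ρ < 1) (h : ∀ n, 2 ≤ n → C.ρ n ≤ ρ) {k n : ℕ}
    (hk : 1 ≤ k) (hkn : k ≤ n) (hρ0 : 0 ≤ ρ) : C.K k n ≤ (1 - ρ)⁻¹ := by
  have h1 : 0 < 1 - ρ := by linarith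
  induction hkn using Nat.decreasingInduction with
  | self => rw [K_self, one_le_inv₀ h1]; linarith
  | of_succ k hkn ih =>
    rw [C.K_eq_one_add hkn]
    have h2 := ih (by omega)
    have h3 : C.ρ (k + 1) * C.K (k + 1) n ≤ ρ * (1 - ρ)⁻¹ :=
      mul_le_mul (h _ (by omega)) h2 (zero_le_one.trans (C.one_le_K (by omega) hkn)) hρ0
    have h4 : 1 + ρ * (1 - ρ)⁻¹ = (1 - ρ)⁻¹ := by field_simp; ring
    linarith

/-- Backward induction with the supersolution `A (k + N)^α`. With `u = k + 1 + N`, the step from `k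
+ 1` to `k` loses at most `A u^{α-1} ≤ A ρ / 2`, by the choice of the shift `N`, while the
contraction gains at least `A ρ`. The net gain `A ρ / 2 ≥ 1` pays for the summand `1` of the
recursion. -/
theorem K_le_mul_rpow_add {α ρ A : ℝ} {N : ℕ} (hα0 : 0 ≤ α) (hα1 : α ≤ 1) (hρ : 0 < ρ)
    (hA : 1 ≤ A) (hAρ : 2 ≤ A * ρ) (hN : 1 ≤ N) (hNρ : (N : ℝ) ^ (α - 1) ≤ ρ / 2)
    (h : ∀ n : ℕ, 2 ≤ n → C.ρ n ≤ 1 - ρ / (n : ℝ) ^ α) {k n : ℕ} (hk : 1 ≤ k) (hkn : k ≤ n) :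
    C.K k n ≤ A * ((k : ℝ) + N) ^ α := by
  have hN' : (1 : ℝ) ≤ N := by exact_mod_cast hN
  induction hkn using Nat.decreasingInduction with
  | self =>
    rw [K_self]
    have : (1 : ℝ) ≤ ((n : ℝ) + N) ^ α :=
      Real.one_le_rpow (by linarith [(Nat.cast_nonneg n : (0 : ℝ) ≤ n)]) hα0
    nlinarith
  | of_succ k hkn ih =>
    have h1 := ih (by omega)
    have hk0 : (0 : ℝ) < ((k + 1 : ℕ) : ℝ) := by positivity
    set u : ℝ := ((k + 1 : ℕ) : ℝ) + N with hu
    have hu1 : 1 ≤ u := by linarith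
    have hu0 : 0 < u := by linarith
    have h2 : u ^ α - u ^ (α - 1) ≤ ((k : ℝ) + N) ^ α := by
      have := rpow_sub_rpow_sub_one_le hu1 hα1
      rwa [show u - 1 = (k : ℝ) + N by rw [hu]; push_cast; ring] at this
    have h3 : u ^ (α - 1) ≤ ρ / 2 :=
      (Real.rpow_le_rpow_of_nonpos (by linarith) (by linarith) (by linarith)).trans hNρ
    have h4 : ((k + 1 : ℕ) : ℝ) ^ α ≤ u ^ α := by
      apply Real.rpow_le_rpow hk0.le _ hα0
      linarith
    have hkα : 0 < ((k + 1 : ℕ) : ℝ) ^ α := by positivity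
    have hAu : 0 ≤ A * u ^ α := by positivity
    have h5 : C.ρ (k + 1) * C.K (k + 1) n ≤ (1 - ρ / ((k + 1 : ℕ) : ℝ) ^ α) * (A * u ^ α) :=
      (mul_le_mul_of_nonneg_left h1 (C.ρ_nonneg _ (by omega))).trans
        (mul_le_mul_of_nonneg_right (h (k + 1) (by omega)) hAu)
    have h6 : ρ * A ≤ ρ / ((k + 1 : ℕ) : ℝ) ^ α * (A * u ^ α) := by
      rw [div_mul_eq_mul_div, le_div_iff₀ hkα, mul_assoc]
      gcongr
    rw [C.K_eq_one_add hkn]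
    have h7 : A * (u ^ α - ρ / 2) ≤ A * ((k : ℝ) + N) ^ α := by
      apply mul_le_mul_of_nonneg_left _ (by linarith)
      linarith
    nlinarith

theorem exists_K_le_mul_rpow {α ρ : ℝ} (hα0 : 0 ≤ α) (hα1 : α < 1) (hρ : 0 < ρ) :
    ∃ B : ℝ, 0 < B ∧ ∀ (𝒳 : Type u) (𝒴 : Type v) (Ω : Type w) [MetricSpace 𝒳]
      [MeasurableSpace 𝒳] [MetricSpace 𝒴] [MeasurableSpace 𝒴] [MeasurableSpace Ω] (P : Measure Ω)
      (C : IteratedChain 𝒳 𝒴 Ω P), (∀ n : ℕ, 2 ≤ n → C.ρ n ≤ 1 - ρ / (n : ℝ) ^ α) →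
      ∀ k n : ℕ, 1 ≤ k → k ≤ n → C.K k n ≤ B * (k : ℝ) ^ α := by
  have htend : Tendsto (fun N : ℕ => (N : ℝ) ^ (α - 1)) atTop (nhds 0) := by
    have := (tendsto_rpow_neg_atTop (show 0 < 1 - α by linarith)).comp tendsto_natCast_atTop_atTop
    simpa [Function.comp_def] using this
  obtain ⟨N, hNρ, hN⟩ := ((htend.eventually_le_const (half_pos hρ)).and
    (eventually_ge_atTop 1)).exists
  refine ⟨(1 + 2 / ρ) * (1 + (N : ℝ)) ^ α, by positivity, ?_⟩
  intro 𝒳 𝒴 Ω _ _ _ _ _ P C h k n hk hkn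
  have h0 : 0 < 2 / ρ := by positivity
  have h1 := C.K_le_mul_rpow_add hα0 hα1.le hρ (A := 1 + 2 / ρ) (by linarith)
    (by rw [add_mul, div_mul_cancel₀ _ hρ.ne']; linarith) hN hNρ h hk hkn
  refine h1.trans ?_
  rw [mul_assoc, ← Real.mul_rpow (by positivity) (by positivity)]
  have hk' : (1 : ℝ) ≤ k := by exact_mod_cast hk
  gcongr
  nlinarith [(Nat.cast_nonneg N : (0 : ℝ) ≤ N)]

theorem osc_le {T η K : ℝ} (hT : 0 ≤ T) {k n : ℕ} (hk : 2 ≤ k) (hkn : k ≤ n) (hK : C.K k n ≤ K)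
    (h : max (C.ξ k) (C.τ k) ≤ η) : C.osc T n k ≤ K * (η * (T + 1)) := by
  have hK0 := zero_le_one.trans (C.one_le_K (by omega : 1 ≤ k) hkn)
  have h1 := (le_max_left _ _).trans h
  have h2 := (le_max_right _ _).trans h
  have h3 := mul_le_mul_of_nonneg_right h2 hT
  refine mul_le_mul hK (by linarith) ?_ (hK0.trans hK)
  exact add_nonneg (mul_nonneg (C.τ_nonneg k hk) hT) (C.ξ_nonneg k hk)

theorem Vsq_le_sum {T : ℝ} (hT : 0 ≤ T) {n : ℕ} {w : ℕ → ℝ}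
    (h : ∀ k, 2 ≤ k → k ≤ n → C.osc T n k ≤ w k) :
    C.Vsq T n ≤ ∑ k ∈ Finset.Icc 2 n, w k ^ 2 := by
  rw [Vsq_eq]
  refine Finset.sum_le_sum fun k hk => ?_
  rw [Finset.mem_Icc] at hk
  exact pow_le_pow_left₀ (C.osc_nonneg hT hk.1 hk.2) (h k hk.1 hk.2) 2

/-! ### Asymptotic rates -/

theorem I₁_eq_zero [SecondCountableTopology 𝒳] [BorelSpace 𝒳] [IsProbabilityMeasure P]
    (hX : essDiam P (C.X 1) < ⊤) {d n : ℕ} {x B : ℝ} (hn : 1 ≤ n) (hB : C.K 1 n ≤ B)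
    (hx : (essDiam P (C.X 1)).toReal * (2 * B) < x) : C.I₁ d n x = 0 := by
  have hPX := Measure.isProbabilityMeasure_map (μ := P) C.measurable_X_one.aemeasurable
  have hK := zero_lt_one.trans_le (C.one_le_K le_rfl hn)
  have hae : ∀ᵐ x ∂(P.map (C.X 1)), C.G x ≤ essDiam P (C.X 1) := by
    have h1 := ENNReal.ae_le_essSup (μ := (P.map (C.X 1)).prod (P.map (C.X 1)))
      (fun z : 𝒳 × 𝒳 => edist z.1 z.2)
    filter_upwards [Measure.ae_ae_of_ae_prod h1] with x hx
    exact (lintegral_mono_ae hx).trans (by simp [essDiam])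
  have hae2 := ae_of_ae_map C.measurable_X_one.aemeasurable hae
  rw [I₁]
  have : P {ω | ENNReal.ofReal (x / (2 * C.K 1 n)) ≤ C.G (C.X 1 ω)} = 0 := by
    rw [ae_iff] at hae2
    refine measure_mono_null (fun ω hω => ?_) hae2
    refine not_le.2 (lt_of_lt_of_le ?_ hω)
    rw [← ENNReal.ofReal_toReal hX.ne]
    refine (ENNReal.ofReal_lt_ofReal_iff_of_nonneg ENNReal.toReal_nonneg).2 ?_
    rw [lt_div_iff₀ (by positivity)]
    refine lt_of_le_of_lt ?_ hx
    gcongr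
  rw [this, mul_zero]

variable [SecondCountableTopology 𝒳] [BorelSpace 𝒳] [SecondCountableTopology 𝒴] [BorelSpace 𝒴]
    [IsProbabilityMeasure P]

/-- Reduces every regime to two estimates: `K_{1,n}` bounded and `V_n² = O(n² / a_n)`. The first
makes `I₁` vanish for large `n`; the second makes the Gaussian exponent of order `a_n`. -/
theorem logDeviation_le {T : ℝ} (hT : 0 ≤ T) (hε : essDiam P (C.ε 1) ≤ ENNReal.ofReal T)
    (hX : essDiam P (C.X 1) < ⊤) {d : ℕ} (hd : 1 ≤ d) {p : ℝ≥0∞} [Fact (1 ≤ p)]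
    {f : ∀ n : ℕ, (Fin n → 𝒳) → PiLp p (fun _ : Fin d => ℝ)}
    (hf : ∀ n, 2 ≤ n → SeparatelyLipschitz (f n)) {a : ℕ → ℝ} (ha : Tendsto a atTop atTop)
    {A B : ℝ} (hA : 0 < A) (hK : ∀ n, 2 ≤ n → C.K 1 n ≤ B)
    (hV : ∀ n : ℕ, 2 ≤ n → C.Vsq T n ≤ A * ((n : ℝ) ^ 2 / a n)) {x : ℝ} (hx : 0 < x) :
    C.logDeviation f a x ≤
      ((-((4 * A * ((d : ℝ) ^ (1 / p).toReal) ^ 2)⁻¹ * x ^ 2) : ℝ) : EReal) := by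
  have hd0 : (0 : ℝ) < d := by exact_mod_cast hd
  set r := (d : ℝ) ^ (1 / p).toReal with hr
  have hr0 : 0 < r := Real.rpow_pos_of_pos hd0 _
  set c := (4 * A * r ^ 2)⁻¹ with hc
  have hc0 : 0 < c := by positivity
  refine limsup_le_of_le (by isBoundedDefault) ?_
  have hlin : Tendsto (fun n : ℕ => (n : ℝ) * (x / r)) atTop atTop :=
    tendsto_natCast_atTop_atTop.atTop_mul_const (by positivity)
  have hca : Tendsto (fun n => a n * (c * x ^ 2)) atTop atTop := ha.atTop_mul_const (by positivity)
  filter_upwards [eventually_ge_atTop 2, ha.eventually_gt_atTop 0,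
    hlin.eventually_gt_atTop ((essDiam P (C.X 1)).toReal * (2 * B)),
    hca.eventually_ge_atTop (Real.log (2 * d))] with n hn han hI hlog
  have hn0 : (0 : ℝ) < n := by exact_mod_cast (by omega : 0 < n)
  have h1 := C.hoeffding_deviation_le hT hε (by omega) hd (hf n hn) (x := n * (x / r))
    (by positivity) (hV n hn) (by positivity)
  rw [C.I₁_eq_zero hX (by omega) (hK n hn) hI, zero_add, ← hr,
    show r * (n * (x / r)) = n * x by field_simp,
    show ((n : ℝ) * (x / r)) ^ 2 / (2 * (A * ((n : ℝ) ^ 2 / a n))) = 2 * (a n * (c * x ^ 2)) by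
      rw [hc]; field_simp; norm_num] at h1
  -- Half of the exponent absorbs the prefactor `2d`; hence the `4` in `c` instead of a `2`.
  have h2 : 2 * d * Real.exp (-(2 * (a n * (c * x ^ 2)))) ≤ Real.exp (-(a n * (c * x ^ 2))) := by
    have h3 : (2 * d : ℝ) ≤ Real.exp (a n * (c * x ^ 2)) :=
      (Real.log_le_iff_le_exp (by positivity)).1 hlog
    calc 2 * d * Real.exp (-(2 * (a n * (c * x ^ 2))))
        ≤ Real.exp (a n * (c * x ^ 2)) * Real.exp (-(2 * (a n * (c * x ^ 2)))) := by gcongr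
      _ = _ := by rw [← Real.exp_add]; congr 1; ring
  have h4 := ENNReal.log_monotone (h1.trans (ENNReal.ofReal_le_ofReal h2))
  rw [ENNReal.log_ofReal_of_pos (Real.exp_pos _), Real.log_exp] at h4
  have h5 : (0 : EReal) ≤ ((1 / a n : ℝ) : EReal) := by
    exact_mod_cast (one_div_pos.2 han).le
  refine (mul_le_mul_of_nonneg_left h4 h5).trans (le_of_eq ?_)
  rw [← EReal.coe_mul]
  congr 1
  field_simp

end IteratedChain

namespace IteratedChain

section Rates

variable {𝒳 𝒴 Ω : Type*} [MetricSpace 𝒳] [MeasurableSpace 𝒳]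
    [MetricSpace 𝒴] [MeasurableSpace 𝒴] [MeasurableSpace Ω] {P : Measure Ω}
    {C : IteratedChain 𝒳 𝒴 Ω P}

theorem VanishingContractionAndNoise.Vsq_le {α ρ η T B : ℝ} (hT : 0 ≤ T)
    (h : C.VanishingContractionAndNoise α ρ η)
    (hB : ∀ k n : ℕ, 1 ≤ k → k ≤ n → C.K k n ≤ B * (k : ℝ) ^ α) {n : ℕ} (hn : 2 ≤ n) :
    C.Vsq T n ≤ (B * (η * (T + 1))) ^ 2 * ((n : ℝ) ^ 2 / n) := by
  have h1 := C.Vsq_le_sum hT (n := n) (w := fun _ => B * (η * (T + 1))) fun k hk hkn => by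
    refine (C.osc_le hT hk hkn (hB k n (by omega) hkn) (h k hk).2).trans (le_of_eq ?_)
    -- The growth `k^α` of `K_{k,n}` cancels the decay `k^{-α}` of the noise coefficients, so the
    -- oscillations are uniformly bounded.
    have : (0 : ℝ) < (k : ℝ) ^ α := Real.rpow_pos_of_pos (by exact_mod_cast (by omega : 0 < k)) _
    field_simp
  refine h1.trans ?_
  have hn0 : (0 : ℝ) < n := by exact_mod_cast (by omega : 0 < n)
  rw [Finset.sum_const, nsmul_eq_mul, Nat.card_Icc, mul_comm]
  refine mul_le_mul_of_nonneg_left ?_ (sq_nonneg _)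
  rw [sq, mul_div_cancel_right₀ _ hn0.ne']
  exact_mod_cast (by omega : n + 1 - 2 ≤ n)

theorem VanishingContraction.Vsq_le {α ρ η T B : ℝ} (hT : 0 ≤ T) (hα : 0 ≤ α) (hB0 : 0 ≤ B)
    (hη : 0 ≤ η) (h : C.VanishingContraction α ρ η)
    (hB : ∀ k n : ℕ, 1 ≤ k → k ≤ n → C.K k n ≤ B * (k : ℝ) ^ α) {n : ℕ} (hn : 2 ≤ n) :
    C.Vsq T n ≤ (B * (η * (T + 1))) ^ 2 * ((n : ℝ) ^ 2 / (n : ℝ) ^ (1 - 2 * α)) := by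
  have hn0 : (0 : ℝ) < n := by exact_mod_cast (by omega : 0 < n)
  have h1 := C.Vsq_le_sum hT (n := n) (w := fun _ => B * (n : ℝ) ^ α * (η * (T + 1)))
    fun k hk hkn => by
      refine (C.osc_le hT hk hkn (hB k n (by omega) hkn) (h k hk).2).trans ?_
      have : (k : ℝ) ≤ n := by exact_mod_cast hkn
      gcongr
  refine h1.trans ?_
  have e : (n : ℝ) ^ 2 / (n : ℝ) ^ (1 - 2 * α) = n * ((n : ℝ) ^ α) ^ 2 := by
    rw [← Real.rpow_natCast ((n : ℝ) ^ α) 2, ← Real.rpow_mul hn0.le, ← Real.rpow_natCast _ 2,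
      ← Real.rpow_sub hn0, ← Real.rpow_one_add' hn0.le (by push_cast; linarith)]
    congr 1
    push_cast
    ring
  rw [Finset.sum_const, nsmul_eq_mul, Nat.card_Icc, e]
  have h2 : ((n + 1 - 2 : ℕ) : ℝ) ≤ n := by exact_mod_cast (by omega : n + 1 - 2 ≤ n)
  calc ((n + 1 - 2 : ℕ) : ℝ) * (B * (n : ℝ) ^ α * (η * (T + 1))) ^ 2
      ≤ n * (B * (n : ℝ) ^ α * (η * (T + 1))) ^ 2 := by gcongr
    _ = _ := by ring

theorem VanishingNoise.Vsq_le {α ρ η T : ℝ} (hT : 0 ≤ T) (hρ0 : 0 ≤ ρ) (hρ1 : ρ < 1)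
    (h : C.VanishingNoise α ρ η) {n : ℕ} :
    C.Vsq T n ≤ ((1 - ρ)⁻¹ * (η * (T + 1))) ^ 2 *
      ∑ k ∈ Finset.Icc 2 n, (k : ℝ) ^ (-(2 * α)) := by
  have h1 := C.Vsq_le_sum hT (n := n) (w := fun k => (1 - ρ)⁻¹ * (η / (k : ℝ) ^ α * (T + 1)))
    fun k hk hkn => C.osc_le hT hk hkn
      (C.K_le_inv hρ1 (fun n hn => (h n hn).1) (by omega) hkn hρ0) (h k hk).2
  refine h1.trans (le_of_eq ?_)
  rw [Finset.mul_sum]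
  refine Finset.sum_congr rfl fun k _ => ?_
  rw [Real.rpow_neg (Nat.cast_nonneg k), mul_comm 2 α, Real.rpow_mul (Nat.cast_nonneg k),
    Real.rpow_ofNat]
  ring

end Rates

/-- Every rate is attained with a constant that depends only on the parameters. -/
theorem exists_logDeviation_le (d : ℕ) (hd : 1 ≤ d) (p : ℝ≥0∞) [Fact (1 ≤ p)] {T : ℝ}
    (hT : 0 ≤ T) {α ρ η : ℝ} (hρ0 : 0 < ρ) (hρ1 : ρ < 1) (hη : 0 < η) :
    ∃ c : ℝ, 0 < c ∧
      ∀ (𝒳 : Type u) (𝒴 : Type v) (Ω : Type w)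
        [MetricSpace 𝒳] [SecondCountableTopology 𝒳] [MeasurableSpace 𝒳] [BorelSpace 𝒳]
        [MetricSpace 𝒴] [SecondCountableTopology 𝒴] [MeasurableSpace 𝒴] [BorelSpace 𝒴]
        [MeasurableSpace Ω] (P : Measure Ω) [IsProbabilityMeasure P]
        (C : IteratedChain 𝒳 𝒴 Ω P),
        essDiam P (C.ε 1) ≤ ENNReal.ofReal T → essDiam P (C.X 1) < ⊤ →
        ∀ (f : ∀ n : ℕ, (Fin n → 𝒳) → PiLp p (fun _ : Fin d => ℝ)),
        (∀ n, 2 ≤ n → SeparatelyLipschitz (f n)) →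
        ∀ x : ℝ, 0 < x →
          (0 ≤ α → α < 1 → C.VanishingContractionAndNoise α ρ η →
            C.logDeviation f (fun n => (n : ℝ)) x ≤ ((-(c * x ^ 2) : ℝ) : EReal)) ∧
          (0 < α → α < 1 / 2 → C.VanishingContraction α ρ η →
            C.logDeviation f (fun n => (n : ℝ) ^ (1 - 2 * α)) x ≤ ((-(c * x ^ 2) : ℝ) : EReal)) ∧
          (C.VanishingNoise α ρ η →
            (0 < α → α < 1 / 2 →
              C.logDeviation f (fun n => (n : ℝ) ^ (1 + 2 * α)) x ≤
                ((-(c * x ^ 2) : ℝ) : EReal)) ∧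
            (α = 1 / 2 →
              C.logDeviation f (fun n => (n : ℝ) ^ 2 / Real.log n) x ≤
                ((-(c * x ^ 2) : ℝ) : EReal)) ∧
            (1 / 2 < α → α < 1 →
              C.logDeviation f (fun n => (n : ℝ) ^ 2) x ≤ ((-(c * x ^ 2) : ℝ) : EReal))) := by
  have hd0 : (0 : ℝ) < d := by exact_mod_cast hd
  have hr0 : 0 < (d : ℝ) ^ (1 / p).toReal := Real.rpow_pos_of_pos hd0 _
  have hmono : ∀ {A A' x : ℝ}, 0 < A → A ≤ A' →
      ((-((4 * A * ((d : ℝ) ^ (1 / p).toReal) ^ 2)⁻¹ * x ^ 2) : ℝ) : EReal) ≤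
      ((-((4 * A' * ((d : ℝ) ^ (1 / p).toReal) ^ 2)⁻¹ * x ^ 2) : ℝ) : EReal) := by
    intro A A' x hA hAA'
    rw [EReal.coe_le_coe_iff, neg_le_neg_iff]
    gcongr
  obtain ⟨B, hB0, hB⟩ : ∃ B : ℝ, 0 < B ∧ (0 ≤ α → α < 1 → ∀ (𝒳 : Type u) (𝒴 : Type v)
      (Ω : Type w) [MetricSpace 𝒳] [MeasurableSpace 𝒳] [MetricSpace 𝒴] [MeasurableSpace 𝒴]
      [MeasurableSpace Ω] (P : Measure Ω) (C : IteratedChain 𝒳 𝒴 Ω P),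
      (∀ n : ℕ, 2 ≤ n → C.ρ n ≤ 1 - ρ / (n : ℝ) ^ α) →
      ∀ k n : ℕ, 1 ≤ k → k ≤ n → C.K k n ≤ B * (k : ℝ) ^ α) := by
    by_cases h : 0 ≤ α ∧ α < 1
    · obtain ⟨B, hB0, hB⟩ := exists_K_le_mul_rpow h.1 h.2 hρ0
      exact ⟨B, hB0, fun _ _ => hB⟩
    · exact ⟨1, one_pos, fun h0 h1 => absurd ⟨h0, h1⟩ h⟩
  obtain ⟨M, hM0, hM⟩ : ∃ M : ℝ, 0 < M ∧
      (α < 1 / 2 → 1 / (1 - 2 * α) ≤ M) ∧ 1 ≤ M ∧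
      (1 / 2 < α → ∀ n : ℕ, ∑ k ∈ Finset.Icc 2 n, (k : ℝ) ^ (-(2 * α)) ≤ M) := by
    -- One `M` serves all three noise regimes. Each summand matters only in its own range of `α`;
    -- elsewhere, including the default values `1 / 0 = 0` and `0` for a divergent series, it is
    -- merely nonnegative.
    refine ⟨1 + |1 / (1 - 2 * α)| + ∑' k : ℕ, (k : ℝ) ^ (-(2 * α)), ?_, ?_, ?_, ?_⟩
    all_goals
      have h1 : 0 ≤ ∑' k : ℕ, (k : ℝ) ^ (-(2 * α)) :=
        tsum_nonneg fun k => Real.rpow_nonneg (Nat.cast_nonneg k) _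
      have h2 := abs_nonneg (1 / (1 - 2 * α))
    · linarith
    · intro _
      linarith [le_abs_self (1 / (1 - 2 * α))]
    · linarith
    · intro hα n
      have hs : Summable fun k : ℕ => (k : ℝ) ^ (-(2 * α)) :=
        Real.summable_nat_rpow.2 (by linarith)
      have := hs.sum_le_tsum (Finset.Icc 2 n)
        (fun k _ => Real.rpow_nonneg (Nat.cast_nonneg k) _)
      linarith
  obtain ⟨hM1, hM2, hM3⟩ := hM
  obtain ⟨A₁, hA₁⟩ : ∃ A₁, A₁ = (B * (η * (T + 1))) ^ 2 := ⟨_, rfl⟩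
  obtain ⟨A₂, hA₂⟩ : ∃ A₂, A₂ = ((1 - ρ)⁻¹ * (η * (T + 1))) ^ 2 := ⟨_, rfl⟩
  have h1ρ : 0 < 1 - ρ := by linarith
  have hA₁0 : 0 < A₁ := by rw [hA₁]; positivity
  have hA₂0 : 0 < A₂ := by rw [hA₂]; positivity
  have hA₃0 : 0 < A₂ * M := by positivity
  -- The rate constant decreases in the variance constant, so the sum `A₁ + A₂ M` gives one `c`
  -- valid in all five regimes.
  refine ⟨(4 * (A₁ + A₂ * M) * ((d : ℝ) ^ (1 / p).toReal) ^ 2)⁻¹, by positivity, ?_⟩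
  intro 𝒳 𝒴 Ω _ _ _ _ _ _ _ _ _ P _ C hε hX f hf x hx
  have hnat := tendsto_natCast_atTop_atTop (R := ℝ)
  refine ⟨fun h0 h1 h => ?_, fun h0 h1 h => ?_, fun h => ⟨fun h0 h1 => ?_, fun h0 => ?_,
    fun h0 h1 => ?_⟩⟩
  · have hK := hB h0 h1 𝒳 𝒴 Ω P C fun n hn => (h n hn).1
    refine (C.logDeviation_le hT hε hX hd hf hnat hA₁0 (B := B) (fun n hn => ?_)
      (fun n hn => hA₁ ▸ h.Vsq_le hT hK hn) hx).trans (hmono hA₁0 (by linarith))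
    simpa using hK 1 n le_rfl (by omega)
  · have hK := hB h0.le (by linarith) 𝒳 𝒴 Ω P C fun n hn => (h n hn).1
    refine (C.logDeviation_le hT hε hX hd hf
      ((tendsto_rpow_atTop (by linarith)).comp hnat) hA₁0 (B := B) (fun n hn => ?_)
      (fun n hn => hA₁ ▸ h.Vsq_le hT h0.le hB0.le hη.le hK hn) hx).trans (hmono hA₁0 (by linarith))
    simpa using hK 1 n le_rfl (by omega)
  all_goals
    have hK : ∀ n, 2 ≤ n → C.K 1 n ≤ (1 - ρ)⁻¹ := fun n hn =>
      C.K_le_inv hρ1 (fun n hn => (h n hn).1) le_rfl (by omega) hρ0.le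
    have hV : ∀ n, C.Vsq T n ≤ A₂ * ∑ k ∈ Finset.Icc 2 n, (k : ℝ) ^ (-(2 * α)) := fun n =>
      hA₂ ▸ h.Vsq_le hT hρ0.le hρ1
  · refine (C.logDeviation_le hT hε hX hd hf ((tendsto_rpow_atTop (by linarith)).comp hnat)
      hA₃0 hK (fun n hn => ?_) hx).trans (hmono hA₃0 (by linarith))
    have hn0 : (0 : ℝ) < n := by exact_mod_cast (by omega : 0 < n)
    refine (hV n).trans ?_
    rw [mul_assoc]
    refine mul_le_mul_of_nonneg_left ?_ hA₂0.le
    refine (sum_Icc_rpow_neg_le (by linarith) (by linarith) (by omega)).trans ?_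
    have e : (n : ℝ) ^ 2 / (n : ℝ) ^ (1 + 2 * α) = (n : ℝ) ^ (1 - 2 * α) := by
      rw [← Real.rpow_natCast _ 2, ← Real.rpow_sub hn0]
      congr 1
      push_cast
      ring
    simp only [Function.comp]
    rw [e, div_eq_mul_one_div, mul_comm]
    exact mul_le_mul_of_nonneg_right (hM1 h1) (Real.rpow_nonneg hn0.le _)
  · have hlog : Tendsto (fun n : ℕ => (n : ℝ) ^ 2 / Real.log n) atTop atTop := by
      refine tendsto_atTop_mono' atTop ?_ hnat
      filter_upwards [eventually_ge_atTop 2] with n hn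
      have hn1 : (1 : ℝ) < n := by exact_mod_cast (by omega : 1 < n)
      rw [le_div_iff₀ (Real.log_pos hn1), sq]
      have := Real.log_le_sub_one_of_pos (by linarith : (0 : ℝ) < n)
      exact mul_le_mul_of_nonneg_left (by linarith) (by linarith)
    refine (C.logDeviation_le hT hε hX hd hf hlog
      hA₃0 hK (fun n hn => ?_) hx).trans (hmono hA₃0 (by linarith))
    have hn1 : (1 : ℝ) < n := by exact_mod_cast (by omega : 1 < n)
    have hln := Real.log_pos hn1
    refine (hV n).trans ?_
    rw [mul_assoc]
    refine mul_le_mul_of_nonneg_left ?_ hA₂0.le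
    have e : (n : ℝ) ^ 2 / ((n : ℝ) ^ 2 / Real.log n) = Real.log n := by field_simp
    rw [e]
    have := sum_Icc_inv_le_log (n := n) (by omega)
    rw [h0]
    norm_num [Real.rpow_neg_one]
    nlinarith
  · have hsq : Tendsto (fun n : ℕ => (n : ℝ) ^ 2) atTop atTop :=
      (tendsto_pow_atTop two_ne_zero).comp hnat
    refine (C.logDeviation_le hT hε hX hd hf hsq
      hA₃0 hK (fun n hn => ?_) hx).trans (hmono hA₃0 (by linarith))
    have hn0 : (0 : ℝ) < n := by exact_mod_cast (by omega : 0 < n)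
    refine (hV n).trans ?_
    rw [div_self (by positivity), mul_one]
    exact mul_le_mul_of_nonneg_left (hM3 h0 n) hA₂0.le

end IteratedChain

/-- The constants `c` are chosen before the spaces, the chain and the functions `f n`: they depend only on
`p`, `d`, `T₁`, `α`, `ρ`, `η`. -/
theorem proposition3p6 (d : ℕ) (hd : 1 ≤ d) (p : ℝ≥0∞) [Fact (1 ≤ p)]
    (T₁ : ℝ) (hT₁ : 0 < T₁) :
    -- the deviation bounds for fixed `n`
    (∀ (𝒳 : Type u) (𝒴 : Type v) (Ω : Type w)
        [MetricSpace 𝒳] [CompleteSpace 𝒳] [TopologicalSpace.SeparableSpace 𝒳]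
        [MeasurableSpace 𝒳] [BorelSpace 𝒳]
        [MetricSpace 𝒴] [CompleteSpace 𝒴] [TopologicalSpace.SeparableSpace 𝒴]
        [MeasurableSpace 𝒴] [BorelSpace 𝒴]
        [MeasurableSpace Ω] (P : Measure Ω) [IsProbabilityMeasure P]
        (C : IteratedChain 𝒳 𝒴 Ω P),
        essDiam P (C.ε 1) ≤ ENNReal.ofReal T₁ →
        ∀ (n : ℕ), 2 ≤ n →
        ∀ (f : (Fin n → 𝒳) → PiLp p (fun _ : Fin d => ℝ)), SeparatelyLipschitz f →
        ∀ x ∈ Set.Icc (0 : ℝ) (2 * C.D T₁ n),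
          P {ω | (d : ℝ) ^ (1 / p).toReal * x ≤ ‖C.S f ω‖} ≤
              C.I₁ d n x + 2 * d * EReal.exp
                (-(((C.D T₁ n ^ 2 / C.Vsq T₁ n : ℝ) : EReal) * rioEllStar (x / (2 * C.D T₁ n)))) ∧
          P {ω | (d : ℝ) ^ (1 / p).toReal * x ≤ ‖C.S f ω‖} ≤
              C.I₁ d n x + ENNReal.ofReal (2 * d * ((C.D T₁ n - x / 2) / C.D T₁ n) ^
                ((C.D T₁ n * x - (x / 2) ^ 2) / C.Vsq T₁ n)) ∧
          C.I₁ d n x + ENNReal.ofReal (2 * d * ((C.D T₁ n - x / 2) / C.D T₁ n) ^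
                ((C.D T₁ n * x - (x / 2) ^ 2) / C.Vsq T₁ n)) ≤
              C.I₁ d n x + ENNReal.ofReal (2 * d * Real.exp (-(x ^ 2 / (2 * C.Vsq T₁ n))))) ∧
    -- the asymptotic rates
    (∀ (α ρ η : ℝ), 0 < ρ → ρ < 1 → 0 < η →
      ∃ c : ℝ, 0 < c ∧
        ∀ (𝒳 : Type u) (𝒴 : Type v) (Ω : Type w)
          [MetricSpace 𝒳] [CompleteSpace 𝒳] [TopologicalSpace.SeparableSpace 𝒳]
          [MeasurableSpace 𝒳] [BorelSpace 𝒳]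
          [MetricSpace 𝒴] [CompleteSpace 𝒴] [TopologicalSpace.SeparableSpace 𝒴]
          [MeasurableSpace 𝒴] [BorelSpace 𝒴]
          [MeasurableSpace Ω] (P : Measure Ω) [IsProbabilityMeasure P]
          (C : IteratedChain 𝒳 𝒴 Ω P),
          essDiam P (C.ε 1) ≤ ENNReal.ofReal T₁ → essDiam P (C.X 1) < ⊤ →
          ∀ (f : ∀ n : ℕ, (Fin n → 𝒳) → PiLp p (fun _ : Fin d => ℝ)),
          (∀ n, 2 ≤ n → SeparatelyLipschitz (f n)) →
          ∀ x : ℝ, 0 < x →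
            (0 ≤ α → α < 1 → C.VanishingContractionAndNoise α ρ η →
              C.logDeviation f (fun n => (n : ℝ)) x ≤ ((-(c * x ^ 2) : ℝ) : EReal)) ∧
            (0 < α → α < 1 / 2 → C.VanishingContraction α ρ η →
              C.logDeviation f (fun n => (n : ℝ) ^ (1 - 2 * α)) x ≤ ((-(c * x ^ 2) : ℝ) : EReal)) ∧
            (C.VanishingNoise α ρ η →
              (0 < α → α < 1 / 2 →
                C.logDeviation f (fun n => (n : ℝ) ^ (1 + 2 * α)) x ≤
                  ((-(c * x ^ 2) : ℝ) : EReal)) ∧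
              (α = 1 / 2 →
                C.logDeviation f (fun n => (n : ℝ) ^ 2 / Real.log n) x ≤
                  ((-(c * x ^ 2) : ℝ) : EReal)) ∧
              (1 / 2 < α → α < 1 →
                C.logDeviation f (fun n => (n : ℝ) ^ 2) x ≤
                  ((-(c * x ^ 2) : ℝ) : EReal)))) := by
  refine ⟨?_, fun α ρ η hρ0 hρ1 hη => ?_⟩
  · intro 𝒳 𝒴 Ω _ _ _ _ _ _ _ _ _ _ _ P _ C hε n hn f hf x hx
    have := UniformSpace.secondCountable_of_separable 𝒳
    have := UniformSpace.secondCountable_of_separable 𝒴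
    exact ⟨C.rioEllStar_deviation_le hT₁.le hε (by omega) hd hf x,
      C.power_deviation_le hT₁.le hε (by omega) hd hf hx, C.power_le_gaussian hx⟩
  · obtain ⟨c, hc, h⟩ := IteratedChain.exists_logDeviation_le d hd p hT₁.le (α := α) hρ0 hρ1 hη
    refine ⟨c, hc, ?_⟩
    intro 𝒳 𝒴 Ω _ _ _ _ _ _ _ _ _ _ _ P _ C
    have := UniformSpace.secondCountable_of_separable 𝒳
    have := UniformSpace.secondCountable_of_separable 𝒴
    exact h 𝒳 𝒴 Ω P C
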